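/- For $q\in\mathbb{C}$ with $0<|q|<1$ and $x,y\in\mathbb{C}\setminus\{0\}$ let $$j(x;q)=\sum_{n\in\mathbb{Z}}(-1)^nq^{\binom n2}x^n,\qquad J_{a,m}=j(q^a;q^m),\qquad J_m=J_{m,3m}=\prod_{i\ge1}(1-q^{mi}),$$ $$f_{a,b,c}(x,y,q)=\Big(\sum_{r,s\ge0}-\sum_{r,s<0}\Big)(-1)^{r+s}x^ry^sq^{a\binom r2+brs+c\binom s2}.$$ Then, for all $q$ with $0<|q|<1$, the double sum $f_{4,4,1}(q^4,q^3,q)$ converges absolutely and $$f_{4,4,1}(q^4,q^3,q)=J_2\,J_{3,12}.$$ This is equivalent to the Kac–Peterson evaluation of the level-$6$ string function $c_{51}^{33}$ of the affine algebra $A_1^{(1)}$. For $\tau$ in the upper half-plane let $q^x=e^{2\pi i x\tau}$ for real $x$, let $\eta(\tau)=q^{1/24}\prod_{n\ge1}(1-q^n)$, and let the string function be given by the Kac–Peterson formula (level $N$, with $\mathrm{sg}(x)=1$ for $x\ge0$ and $\mathrm{sg}(x)=-1$ for $x<0$) $$c^{N-\ell,\ell}_{N-m,m}(\tau)=\frac1{\eta(\tau)^3}\sum_{\substack{(x,y)\in\mathbb{R}^2,\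 -|x|<y\le|x|\\ (x,y)\text{ or }(\frac12-x,\frac12+y)\,\in\,\left(\frac{\ell+1}{2(N+2)},\frac m{2N}\right)+\mathbb{Z}^2}}\mathrm{sg}(x)\,q^{(N+2)x^2-Ny^2}.$$ Then for every $\tau$ the sum for $c_{51}^{33}$ (that is, $N=6$, $\ell=3$, $m=1$) converges absolutely, $$c_{51}^{33}(\tau)=\frac{q^{1/3}}{J_1^3}\,f_{4,4,1}(q^4,q^3,q),\qquad \tfrac13=-\tfrac18+\tfrac{(\ell+1)^2}{4(N+2)}-\tfrac{m^2}{4N},$$ and $$c_{51}^{33}(\tau)=\eta(\tau)^{-3}\eta(2\tau)\eta(3\tau)\eta(6\tau)^{-1}\eta(12\tau).$$ -/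

import Mathlib

noncomputable section

namespace StringFn

/-- The theta function `j(x; q) = ∑_{n ∈ ℤ} (-1)^n q^{n(n-1)/2} x^n`. -/
def theta (x q : ℂ) : ℂ :=
  ∑' n : ℤ, (-1 : ℂ) ^ n * q ^ (n * (n - 1) / 2) * x ^ n

/-- `J_{a,m} = j(q^a; q^m)`. -/
def thetaJ (a m : ℤ) (q : ℂ) : ℂ := theta (q ^ a) (q ^ m)

/-- `J_m = J_{m,3m}`. -/
def eulerJ (m : ℤ) (q : ℂ) : ℂ := thetaJ m (3 * m) q

/-- The term of index `(r, s)` of the Hecke-type double sum, with its sign: the summand counts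
positively on `r, s ≥ 0`, negatively on `r, s < 0`, and is absent elsewhere. -/
def heckeTerm (a b c : ℤ) (x y q : ℂ) (p : ℤ × ℤ) : ℂ :=
  (if 0 ≤ p.1 ∧ 0 ≤ p.2 then 1 else if p.1 < 0 ∧ p.2 < 0 then -1 else 0) *
    ((-1 : ℂ) ^ (p.1 + p.2) * x ^ p.1 * y ^ p.2 *
      q ^ (a * (p.1 * (p.1 - 1) / 2) + b * p.1 * p.2 + c * (p.2 * (p.2 - 1) / 2)))

/-- The Hecke-type double sum `f_{a,b,c}(x, y, q)`. -/
def heckeF (a b c : ℤ) (x y q : ℂ) : ℂ := ∑' p : ℤ × ℤ, heckeTerm a b c x y q p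

/-- `q^x = e^{2πi x τ}` for a real exponent `x`, where `q = e^{2πiτ}`. -/
def qPow (τ : UpperHalfPlane) (x : ℝ) : ℂ :=
  Complex.exp (2 * Real.pi * Complex.I * (x : ℂ) * (τ : ℂ))

/-- The translated lattice `((ℓ+1)/(2(N+2)), m/(2N)) + ℤ²`. -/
def shiftedLattice (N l m : ℤ) : Set (ℝ × ℝ) :=
  {p | ∃ i k : ℤ, p = (((l : ℝ) + 1) / (2 * ((N : ℝ) + 2)) + i, (m : ℝ) / (2 * (N : ℝ)) + k)}

/-- The index set of the Kac–Peterson double sum for the string function of level `N`. -/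
def stringIndex (N l m : ℤ) : Set (ℝ × ℝ) :=
  {p | -|p.1| < p.2 ∧ p.2 ≤ |p.1| ∧
    (p ∈ shiftedLattice N l m ∨ (1 / 2 - p.1, 1 / 2 + p.2) ∈ shiftedLattice N l m)}

/-- The term `sg(x) q^{(N+2)x² - N y²}` of the Kac–Peterson double sum. -/
def stringTerm (N : ℤ) (τ : UpperHalfPlane) (p : ℝ × ℝ) : ℂ :=
  (if 0 ≤ p.1 then 1 else -1) * qPow τ (((N : ℝ) + 2) * p.1 ^ 2 - (N : ℝ) * p.2 ^ 2)

/-- The string function `c^{N-ℓ,ℓ}_{N-m,m}(τ)` of level `N` of the affine algebra `A₁⁽¹⁾`,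
in the Kac–Peterson form of an indefinite double sum divided by `η(τ)³`. -/
def stringFunction (N l m : ℤ) (τ : UpperHalfPlane) : ℂ :=
  (ModularForm.eta (τ : ℂ) ^ 3)⁻¹ * ∑' p : stringIndex N l m, stringTerm N τ p

/-- `s(m, ℓ, N) = -1/8 + (ℓ+1)²/(4(N+2)) - m²/(4N)`. -/
def sExponent (m l N : ℤ) : ℝ :=
  -(1 / 8) + ((l : ℝ) + 1) ^ 2 / (4 * ((N : ℝ) + 2)) - (m : ℝ) ^ 2 / (4 * (N : ℝ))

end StringFn

end

noncomputable section

namespace StringFn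

open Filter Topology Finset

/-! ### Triangular exponents -/

/-! Write c(k) for `recipCoeff q k`. On |q| < |x| < 1 one has J₁³ / j(x;q) = ∑ c(k) x^k. Summing the
Hecke series over s first turns f = f_{4,4,1}(q⁴,q³,q) into ∑_r (-1)^r q^{2r(r-1)} c(2-4r), which is
J₁³ times the coefficient of x² in j(x⁴;q⁴) / j(x;q).

Two uses of j(x;q) j(-x;q) = j(q;q²) j(x²;q²) rewrite this quotient as j(-x;q) j(-x²;q²) / (j(q;q²)
j(q²;q⁴)). The coefficient of x² in the numerator is again a theta series, j(-q⁵;q⁶). Hence j(q;q²)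
j(q²;q⁴) f = J₁³ j(-q⁵;q⁶), which is `theta_mul_theta_mul_heckeF`; the triple product
`theta_eq_poch` turns the thetas into products and yields J₂ J_{3,12}.

Everything is done on coefficients: `recipConv_eq_zero` and `recipConv_zero` say that the c(k)
invert j(x;q) up to J₁³, and `tsum_theta_conv` is the product j(x;q) j(-x;q) paired with a bounded
sequence. For the string function, `bijOn_toIndex` matches the Kac–Peterson index set with the two
quadrants of the Hecke sum, term by term. -/

theorem two_mul_tri (n : ℤ) : 2 * (n * (n - 1) / 2) = n * (n - 1) :=
  Int.mul_ediv_cancel' (by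
    have := Int.even_mul_pred_self n
    exact this.two_dvd)

theorem eq_of_two_mul {a b : ℤ} (h : 2 * a = 2 * b) : a = b := by omega

/-! ### Infinite products -/

/-- The infinite `q`-shifted factorial `∏_{n ≥ 0} (1 - x q^n)`. -/
def poch (x q : ℂ) : ℂ := ∏' n : ℕ, (1 - x * q ^ n)

theorem summable_norm_mul_pow (x : ℂ) {q : ℂ} (hq : ‖q‖ < 1) :
    Summable fun n : ℕ => ‖-(x * q ^ n)‖ := by
  simpa using (summable_geometric_of_lt_one (norm_nonneg _) hq).mul_left ‖x‖

theorem multipliable_poch (x : ℂ) {q : ℂ} (hq : ‖q‖ < 1) :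
    Multipliable fun n : ℕ => 1 - x * q ^ n := by
  simpa [sub_eq_add_neg] using multipliable_one_add_of_summable (summable_norm_mul_pow x hq)

theorem poch_self_ne_zero {q : ℂ} (hq : ‖q‖ < 1) : poch q q ≠ 0 := by
  have := tprod_one_add_ne_zero_of_summable (f := fun n : ℕ => -(q * q ^ n)) (fun n h => by
    have h1 : q ^ (n + 1) = 1 := by linear_combination -h
    have h2 : ‖q‖ ^ (n + 1) < 1 := pow_lt_one₀ (norm_nonneg _) hq (by omega)
    rw [← norm_pow, h1, norm_one] at h2
    exact lt_irrefl _ h2) (summable_norm_mul_pow q hq)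
  simpa [poch, sub_eq_add_neg] using this

theorem poch_eq_mul (x : ℂ) {q : ℂ} (hq : ‖q‖ < 1) :
    poch x q = (1 - x) * poch (x * q) q := by
  rw [poch, tprod_eq_zero_mul' ?_]
  · simp [poch, pow_succ', mul_assoc]
  · simpa [pow_succ', mul_assoc] using multipliable_poch (x * q) hq

/-- Splitting of an infinite product into residue classes. -/
theorem poch_eq_prod (k : ℕ) [NeZero k] (x : ℂ) {q : ℂ} (hq : ‖q‖ < 1) :
    poch x q = ∏ j : Fin k, poch (x * q ^ (j : ℕ)) (q ^ k) := by
  have hk : ‖q ^ k‖ < 1 := by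
    rw [norm_pow]; exact pow_lt_one₀ (norm_nonneg _) hq (NeZero.ne k)
  have h := (multipliable_poch x hq).hasProd
  have h2 := (((Nat.divModEquiv k).trans (Equiv.prodComm _ _)).symm.hasProd_iff).mpr h
  have h3 := h2.prod_fiberwise (g := fun j : Fin k => poch (x * q ^ (j : ℕ)) (q ^ k)) (fun j => by
    convert! (multipliable_poch (x * q ^ (j : ℕ)) hk).hasProd using 2 with n
    simp [Nat.divModEquiv]
    ring)
  rw [poch, ← h3.tprod_eq, tprod_fintype]

theorem poch_neg_mul_poch (x : ℂ) {q : ℂ} (hq : ‖q‖ < 1) :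
    poch (-x) q * poch x q = poch (x ^ 2) (q ^ 2) := by
  rw [poch, poch, ← (multipliable_poch _ hq).tprod_mul (multipliable_poch _ hq), poch]
  exact tprod_congr fun n => by ring

/-! ### The `q`-binomial theorem -/

/-- Gaussian binomial coefficients, by the Pascal recursion. -/
def gaussBinom (q : ℂ) : ℕ → ℕ → ℂ
  | _, 0 => 1
  | 0, _ + 1 => 0
  | m + 1, k + 1 => gaussBinom q m k + q ^ (k + 1) * gaussBinom q m (k + 1)

theorem gaussBinom_zero_right (q : ℂ) (m : ℕ) : gaussBinom q m 0 = 1 := by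
  cases m <;> rfl

theorem gaussBinom_of_lt (q : ℂ) : ∀ {m k : ℕ}, m < k → gaussBinom q m k = 0
  | 0, k + 1, _ => rfl
  | m + 1, k + 1, h => by
    rw [gaussBinom, gaussBinom_of_lt q (by omega : m < k),
      gaussBinom_of_lt q (by omega : m < k + 1)]
    simp

/-- The finite product `∏_{i=1}^{n} (1 - q^i)`. -/
def qFactorial (q : ℂ) (n : ℕ) : ℂ := ∏ i ∈ range n, (1 - q * q ^ i)

theorem gaussBinom_self (q : ℂ) (m : ℕ) : gaussBinom q m m = 1 := by
  induction m with
  | zero => rfl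
  | succ m ih => rw [gaussBinom, ih, gaussBinom_of_lt q (Nat.lt_succ_self m)]; simp

/-- Free of division, so the Pascal induction works for every q, roots of unity included. -/
theorem gaussBinom_mul_qFactorial (q : ℂ) (n : ℕ) : ∀ a b : ℕ, a + b = n →
    gaussBinom q (a + b) a * (qFactorial q a * qFactorial q b) = qFactorial q (a + b) := by
  induction n with
  | zero =>
    intro a b h
    obtain ⟨rfl, rfl⟩ : a = 0 ∧ b = 0 := by omega
    simp [gaussBinom, qFactorial]
  | succ n ih =>
    rintro (_ | a) (_ | b) h
    · simp [gaussBinom, qFactorial]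
    · simp [gaussBinom_zero_right, qFactorial]
    · simp [gaussBinom_self, qFactorial]
    · have h1 := ih a (b + 1) (by omega)
      have h2 := ih (a + 1) b (by omega)
      have e1 : a + 1 + (b + 1) = (a + b + 1) + 1 := by ring
      have e2 : a + (b + 1) = a + b + 1 := by ring
      have e3 : a + 1 + b = a + b + 1 := by ring
      rw [e2] at h1
      rw [e3] at h2
      have s : ∀ n, qFactorial q (n + 1) = qFactorial q n * (1 - q * q ^ n) := fun n => by
        simp [qFactorial, prod_range_succ]
      rw [e1, gaussBinom, s (a + b + 1)]
      rw [s b] at h1 ⊢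
      rw [s a] at h2 ⊢
      linear_combination (1 - q * q ^ a) * h1 + q ^ (a + 1) * (1 - q * q ^ b) * h2

/-- The product P_m(x) satisfies P_{m+1}(x) = (1 - x) P_m(xq); comparing coefficients gives the
Pascal recursion. -/
theorem prod_one_sub_mul_pow (q : ℂ) (m : ℕ) : ∀ x : ℂ,
    ∏ i ∈ range m, (1 - x * q ^ i) =
      ∑ k ∈ range (m + 1), (-1) ^ k * q ^ (k * (k - 1) / 2) * gaussBinom q m k * x ^ k := by
  induction m with
  | zero => intro x; simp [gaussBinom]
  | succ m ih =>
    intro x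
    have t : ∀ k : ℕ, (k + 1) * (k + 1 - 1) / 2 = k * (k - 1) / 2 + k := fun k => by
      rw [← Nat.choose_two_right, ← Nat.choose_two_right, Nat.choose_succ_succ' k 1]
      simp [add_comm]
    have h : ∏ i ∈ range (m + 1), (1 - x * q ^ i)
        = (1 - x) * ∏ i ∈ range m, (1 - (x * q) * q ^ i) := by
      rw [prod_range_succ']
      rw [mul_comm]
      simp [pow_succ', mul_assoc]
    rw [h, ih, sum_range_succ' _ (m + 1), sub_mul, one_mul]
    simp only [t, gaussBinom]
    have hl : ∑ k ∈ range (m + 1), (-1 : ℂ) ^ k * q ^ (k * (k - 1) / 2) * gaussBinom q m k *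
          (x * q) ^ k = ∑ k ∈ range (m + 1), (-1 : ℂ) ^ (k + 1) * q ^ (k * (k - 1) / 2 + k) *
            gaussBinom q m (k + 1) * (x * q) ^ (k + 1) + 1 := by
      rw [sum_range_succ', sum_range_succ _ m, gaussBinom_of_lt q (Nat.lt_succ_self m)]
      simp only [t]
      simp [gaussBinom_zero_right]
    nth_rewrite 1 [hl]
    rw [mul_sum, add_sub_right_comm, ← sum_sub_distrib]
    congr 1
    · refine sum_congr rfl fun k _ => ?_
      rw [mul_pow, mul_pow]
      ring
    · simp

theorem prod_mul_prod_eq_sum {q x : ℂ} (hq : q ≠ 0) (hx : x ≠ 0) (n : ℕ) :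
    (∏ i ∈ range n, (1 - x * q ^ i)) * ∏ i ∈ range n, (1 - q / x * q ^ i) =
      ∑ k ∈ range (2 * n + 1), (-1 : ℂ) ^ ((k : ℤ) - n) *
        q ^ (((k : ℤ) - n) * ((k : ℤ) - n - 1) / 2) * x ^ ((k : ℤ) - n) *
        gaussBinom q (2 * n) k := by
  -- Starting at x/q^n centres the 2n factors: the upper half is the product in x, and the lower
  -- half, reversed, is the product in q/x up to a monomial.
  have h := prod_one_sub_mul_pow q (2 * n) (x / q ^ n)
  rw [two_mul, prod_range_add] at h
  have h1 : ∏ i ∈ range n, (1 - x / q ^ n * q ^ (n + i)) = ∏ i ∈ range n, (1 - x * q ^ i) :=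
    prod_congr rfl fun i _ => by rw [pow_add]; field_simp
  have h2 : ∀ n : ℕ, ∏ i ∈ range n, (1 - x / q ^ n * q ^ i) =
      (-1) ^ n * x ^ n * (q ^ (n * (n + 1) / 2))⁻¹ * ∏ i ∈ range n, (1 - q / x * q ^ i) := by
    intro n
    induction n with
    | zero => simp
    | succ n ih =>
      have hs : (n + 1) * (n + 1 + 1) / 2 = n * (n + 1) / 2 + (n + 1) := by
        have a1 := (Nat.even_mul_succ_self n).two_dvd
        have a2 := (Nat.even_mul_succ_self (n + 1)).two_dvd
        have a3 : (n + 1) * (n + 1 + 1) = n * (n + 1) + 2 * (n + 1) := by ring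
        omega
      have hh : ∏ i ∈ range (n + 1), (1 - x / q ^ (n + 1) * q ^ i) =
          (∏ i ∈ range n, (1 - x / q ^ n * q ^ i)) * (1 - x / q ^ (n + 1)) := by
        rw [prod_range_succ']
        congr 1
        · exact prod_congr rfl fun i _ => by field_simp; ring
        · simp
      rw [hh, ih, prod_range_succ _ n, hs, pow_add]
      field_simp
      ring
  rw [h1, h2, ← two_mul] at h
  have hc : (-1 : ℂ) ^ n * x ^ n * (q ^ (n * (n + 1) / 2))⁻¹ ≠ 0 := by
    simp [hq, hx]
  apply mul_left_cancel₀ hc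
  rw [mul_comm (∏ i ∈ range n, (1 - x * q ^ i)), ← mul_assoc, h, mul_sum]
  refine sum_congr rfl fun k _ => ?_
  have hm : (-1 : ℂ) ≠ 0 := by norm_num
  have e1 : ((n * (n + 1) / 2 : ℕ) : ℤ) = n * (n + 1) / 2 := by push_cast; rfl
  have e2 : ((k * (k - 1) / 2 : ℕ) : ℤ) = k * (k - 1) / 2 := by
    rcases k with _ | k
    · simp
    · push_cast; simp
  have e3 : (-1 : ℂ) ^ k = (-1) ^ n * (-1) ^ ((k : ℤ) - n) := by
    rw [← zpow_natCast, ← zpow_natCast, ← zpow_add₀ hm]; congr 1; ring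
  have e4 : x ^ k = x ^ n * x ^ ((k : ℤ) - n) := by
    rw [← zpow_natCast, ← zpow_natCast, ← zpow_add₀ hx]; congr 1; ring
  have e5 : q ^ (k * (k - 1) / 2) * ((q ^ n) ^ k)⁻¹ = (q ^ (n * (n + 1) / 2))⁻¹ *
      q ^ (((k : ℤ) - n) * ((k : ℤ) - n - 1) / 2) := by
    rw [← pow_mul, ← zpow_natCast, ← zpow_natCast, ← zpow_natCast, ← zpow_neg, ← zpow_neg,
      ← zpow_add₀ hq, ← zpow_add₀ hq, e1, e2]
    congr 1
    apply eq_of_two_mul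
    have t1 := two_mul_tri k
    have t2 := two_mul_tri ((k : ℤ) - n)
    have t3 := two_mul_tri ((n : ℤ) + 1)
    have t4 : ((n : ℤ) + 1) * (n + 1 - 1) = n * (n + 1) := by ring
    rw [t4] at t3
    push_cast
    linear_combination t1 - t2 + t3
  rw [div_pow, e3, e4, div_eq_mul_inv]
  linear_combination (-1 : ℂ) ^ n * (-1) ^ ((k : ℤ) - n) * gaussBinom q (2 * n) k * x ^ n *
    x ^ ((k : ℤ) - n) * e5

/-! ### The triple product -/

theorem summable_norm_tri_nat {q : ℂ} (hq0 : q ≠ 0) (hq : ‖q‖ < 1) {y : ℂ} (hy : y ≠ 0) :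
    Summable fun n : ℕ => ‖q ^ ((n : ℤ) * (n - 1) / 2) * y ^ (n : ℤ)‖ := by
  refine summable_of_ratio_test_tendsto_lt_one (l := 0) zero_lt_one
    (Eventually.of_forall fun n => by simp [hq0, hy, zpow_ne_zero]) ?_
  have h : Tendsto (fun n : ℕ => ‖q‖ ^ n * ‖y‖) atTop (𝓝 (0 * ‖y‖)) :=
    (tendsto_pow_atTop_nhds_zero_of_lt_one (norm_nonneg _) hq).mul_const _
  rw [zero_mul] at h
  refine h.congr fun n => ?_
  have e : ((n + 1 : ℕ) : ℤ) * (((n + 1 : ℕ) : ℤ) - 1) / 2 = (n : ℤ) * (n - 1) / 2 + n := by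
    apply eq_of_two_mul
    have t1 := two_mul_tri (n : ℤ)
    have t2 := two_mul_tri ((n + 1 : ℕ) : ℤ)
    push_cast at t2 ⊢
    linear_combination t2 - t1
  rw [e, zpow_add₀ hq0, Nat.cast_succ, zpow_add_one₀ hy]
  have a1 : q ^ ((n : ℤ) * (n - 1) / 2) ≠ 0 := zpow_ne_zero _ hq0
  have a2 : y ^ (n : ℤ) ≠ 0 := zpow_ne_zero _ hy
  simp only [norm_norm, norm_mul, zpow_natCast, norm_pow]
  have a1 : ‖q ^ ((n : ℤ) * (n - 1) / 2)‖ ≠ 0 := norm_ne_zero_iff.mpr a1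
  have a2 : ‖y‖ ^ n ≠ 0 := by simp [hy]
  field_simp

theorem summable_norm_tri {q : ℂ} (hq0 : q ≠ 0) (hq : ‖q‖ < 1) {x : ℂ} (hx : x ≠ 0) :
    Summable fun n : ℤ => ‖q ^ (n * (n - 1) / 2) * x ^ n‖ := by
  refine Summable.of_nat_of_neg_add_one (summable_norm_tri_nat hq0 hq hx) ?_
  have h := ((summable_nat_add_iff 2).mpr
    (summable_norm_tri_nat hq0 hq (inv_ne_zero hx))).mul_left ‖x‖
  refine h.congr fun n => ?_
  rw [← norm_mul, Nat.cast_add]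
  congr 1
  have e : -((n : ℤ) + 1) * (-((n : ℤ) + 1) - 1) / 2
      = ((n : ℤ) + (2 : ℕ)) * ((n : ℤ) + (2 : ℕ) - 1) / 2 := by
    congr 1; push_cast; ring
  rw [e, inv_zpow', mul_left_comm]
  congr 1
  nth_rewrite 1 [← zpow_one x]
  rw [← zpow_add₀ hx]
  congr 1

theorem norm_neg_one_zpow (n : ℤ) : ‖(-1 : ℂ) ^ n‖ = 1 := by simp [norm_zpow]

theorem neg_one_zpow_mul_self (n : ℤ) : (-1 : ℂ) ^ n * (-1 : ℂ) ^ n = 1 := by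
  rw [← mul_zpow]; simp

theorem neg_one_zpow_add (m n : ℤ) : (-1 : ℂ) ^ (m + n) = (-1) ^ m * (-1) ^ n :=
  zpow_add₀ (by norm_num) m n

theorem neg_one_zpow_neg (n : ℤ) : (-1 : ℂ) ^ (-n) = (-1) ^ n := by
  rw [← inv_zpow']; norm_num

theorem summable_norm_theta {q : ℂ} (hq0 : q ≠ 0) (hq : ‖q‖ < 1) {x : ℂ} (hx : x ≠ 0) :
    Summable fun n : ℤ => ‖(-1 : ℂ) ^ n * q ^ (n * (n - 1) / 2) * x ^ n‖ :=
  (summable_norm_tri hq0 hq hx).congr fun n => by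
    simp only [norm_mul, norm_neg_one_zpow, one_mul]

theorem tendsto_qFactorial {q : ℂ} (hq : ‖q‖ < 1) :
    Tendsto (qFactorial q) atTop (𝓝 (poch q q)) :=
  (multipliable_poch q hq).hasProd.tendsto_prod_nat

theorem qFactorial_ne_zero {q : ℂ} (hq : ‖q‖ < 1) (n : ℕ) : qFactorial q n ≠ 0 := by
  refine prod_ne_zero_iff.mpr fun i _ h => ?_
  have h1 : q ^ (i + 1) = 1 := by linear_combination -h
  have h2 : ‖q‖ ^ (i + 1) < 1 := pow_lt_one₀ (norm_nonneg _) hq (by omega)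
  rw [← norm_pow, h1, norm_one] at h2
  exact lt_irrefl _ h2

theorem gaussBinom_eq_div {q : ℂ} (hq : ‖q‖ < 1) (a b : ℕ) :
    gaussBinom q (a + b) a = qFactorial q (a + b) * (qFactorial q a)⁻¹ * (qFactorial q b)⁻¹ := by
  have h := gaussBinom_mul_qFactorial q _ a b rfl
  have ha := qFactorial_ne_zero hq a
  have hb := qFactorial_ne_zero hq b
  field_simp
  linear_combination h

/-- Finite q-factorials converge to a nonzero limit, so they and their inverses are bounded. This
supplies the dominating bound for the triple product. -/
theorem exists_norm_gaussBinom_le {q : ℂ} (hq : ‖q‖ < 1) :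
    ∃ C : ℝ, ∀ m k, ‖gaussBinom q m k‖ ≤ C := by
  have h1 := tendsto_qFactorial hq
  have h2 := h1.inv₀ (poch_self_ne_zero hq)
  obtain ⟨A, hA⟩ := (Metric.isBounded_range_of_tendsto _ h1).exists_norm_le
  obtain ⟨B, hB⟩ := (Metric.isBounded_range_of_tendsto _ h2).exists_norm_le
  replace hA : ∀ n, ‖qFactorial q n‖ ≤ A := fun n => hA _ ⟨n, rfl⟩
  replace hB : ∀ n, ‖(qFactorial q n)⁻¹‖ ≤ B := fun n => hB _ ⟨n, rfl⟩
  have hA0 : 0 ≤ A := (norm_nonneg _).trans (hA 0)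
  have hB0 : 0 ≤ B := (norm_nonneg _).trans (hB 0)
  refine ⟨A * B * B, fun m k => ?_⟩
  rcases lt_or_ge m k with h | h
  · rw [gaussBinom_of_lt q h, norm_zero]; positivity
  · obtain ⟨b, rfl⟩ := Nat.exists_eq_add_of_le h
    rw [gaussBinom_eq_div hq, norm_mul, norm_mul]
    gcongr
    · exact hA _
    · exact hB _
    · exact hB _

theorem tendsto_gaussBinom {q : ℂ} (hq : ‖q‖ < 1) (j : ℤ) :
    Tendsto (fun n : ℕ => gaussBinom q (2 * n) ((n + j).toNat)) atTop (𝓝 (poch q q)⁻¹) := by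
  have h1 := tendsto_qFactorial hq
  have h2 := h1.inv₀ (poch_self_ne_zero hq)
  have hp : Tendsto (fun n : ℕ => ((n : ℤ) + j).toNat) atTop atTop := by
    refine tendsto_atTop.mpr fun b => ?_
    filter_upwards [eventually_ge_atTop (b + j.natAbs)] with n hn
    omega
  have hm : Tendsto (fun n : ℕ => ((n : ℤ) - j).toNat) atTop atTop := by
    refine tendsto_atTop.mpr fun b => ?_
    filter_upwards [eventually_ge_atTop (b + j.natAbs)] with n hn
    omega
  have ht : Tendsto (fun n : ℕ => 2 * n) atTop atTop :=
    tendsto_id.const_mul_atTop' (by norm_num)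
  have h := ((h1.comp ht).mul (h2.comp hp)).mul (h2.comp hm)
  rw [mul_inv_cancel₀ (poch_self_ne_zero hq), one_mul] at h
  refine h.congr' ?_
  filter_upwards [eventually_ge_atTop j.natAbs] with n hn
  have e : 2 * n = ((n : ℤ) + j).toNat + ((n : ℤ) - j).toNat := by omega
  simp only [Function.comp]
  nth_rewrite 2 [e]
  rw [gaussBinom_eq_div hq, ← e]

/-- The Jacobi triple product identity. -/
theorem theta_eq_poch {q : ℂ} (hq0 : q ≠ 0) (hq : ‖q‖ < 1) {x : ℂ} (hx : x ≠ 0) :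
    theta x q = poch q q * poch x q * poch (q / x) q := by
  obtain ⟨C, hC⟩ := exists_norm_gaussBinom_le hq
  -- The guard is needed because `toNat` sends negative integers to 0, where the Gaussian binomial
  -- is 1 and not 0.
  let F : ℕ → ℤ → ℂ := fun n j => (-1 : ℂ) ^ j * q ^ (j * (j - 1) / 2) * x ^ j *
    (if -(n : ℤ) ≤ j then gaussBinom q (2 * n) ((n + j).toNat) else 0)
  have hlim : Tendsto (fun n => ∑' j, F n j) atTop
      (𝓝 (∑' j : ℤ, (-1 : ℂ) ^ j * q ^ (j * (j - 1) / 2) * x ^ j * (poch q q)⁻¹)) := by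
    refine tendsto_tsum_of_dominated_convergence
      ((summable_norm_theta hq0 hq hx).mul_right C) (fun j => ?_)
      (Eventually.of_forall fun n j => ?_)
    · refine Tendsto.const_mul _ ((tendsto_gaussBinom hq j).congr' ?_)
      filter_upwards [eventually_ge_atTop j.natAbs] with n hn
      rw [if_pos (by omega)]
    · simp only [F]
      rw [norm_mul]
      gcongr
      split_ifs
      · exact hC _ _
      · rw [norm_zero]; exact (norm_nonneg _).trans (hC 0 0)
  have hfin : ∀ n, ∑' j, F n j =
      (∏ i ∈ range n, (1 - x * q ^ i)) * ∏ i ∈ range n, (1 - q / x * q ^ i) := by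
    intro n
    rw [prod_mul_prod_eq_sum hq0 hx]
    have hinj : Function.Injective fun k : ℕ => (k : ℤ) - n := fun a b h => by
      simpa using h
    rw [← hinj.tsum_eq, tsum_eq_sum (s := range (2 * n + 1))]
    · refine sum_congr rfl fun k _ => ?_
      simp only [F]
      rw [if_pos (by omega)]
      congr 2
      omega
    · intro k hk
      simp only [F]
      rw [if_pos (by omega), gaussBinom_of_lt, mul_zero]
      simp at hk
      omega
    · intro j hj
      have : -(n : ℤ) ≤ j := by
        by_contra h
        exact hj (by simp [F, h])
      exact ⟨(n + j).toNat, by simp only; omega⟩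
  have hprod : Tendsto (fun n => ∑' j, F n j) atTop (𝓝 (poch x q * poch (q / x) q)) := by
    simp only [hfin]
    exact (multipliable_poch x hq).hasProd.tendsto_prod_nat.mul
      (multipliable_poch (q / x) hq).hasProd.tendsto_prod_nat
  have h := tendsto_nhds_unique hlim hprod
  rw [tsum_mul_right] at h
  rw [mul_assoc, ← h, theta]
  field_simp [poch_self_ne_zero hq]

/-! ### Product evaluations -/

theorem norm_pow_lt_one {q : ℂ} (hq : ‖q‖ < 1) {n : ℕ} (hn : n ≠ 0) : ‖q ^ n‖ < 1 := by
  rw [norm_pow]; exact pow_lt_one₀ (norm_nonneg _) hq hn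

theorem poch_odd_mul {q : ℂ} (hq : ‖q‖ < 1) :
    poch q (q ^ 2) * poch (q ^ 2) (q ^ 2) = poch q q := by
  rw [poch_eq_prod 2 q hq]
  simp [Fin.prod_univ_two, pow_two]

theorem eulerJ_eq_poch {q : ℂ} (hq0 : q ≠ 0) (hq : ‖q‖ < 1) {m : ℕ} (hm : m ≠ 0) :
    eulerJ m q = poch (q ^ m) (q ^ m) := by
  have h := poch_eq_prod 3 (q ^ m) (norm_pow_lt_one hq hm)
  have e : q ^ (3 * (m : ℤ)) = (q ^ m) ^ 3 := by
    rw [← pow_mul, ← zpow_natCast]; push_cast; ring_nf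
  rw [eulerJ, thetaJ, e, zpow_natCast, theta_eq_poch (by simp [hq0])
    (norm_pow_lt_one (norm_pow_lt_one hq hm) (by norm_num)) (by simp [hq0]), h]
  have e2 : (q ^ m) ^ 3 / q ^ m = q ^ m * q ^ m := by field_simp
  have e3 : (q ^ m) ^ 3 = q ^ m * (q ^ m) ^ 2 := by ring
  simp only [Fin.prod_univ_three, e2]
  simp
  rw [← e3]
  ring

theorem theta_sq_mul {q : ℂ} (hq0 : q ≠ 0) (hq : ‖q‖ < 1) :
    theta q (q ^ 2) * poch (q ^ 2) (q ^ 2) = poch q q ^ 2 := by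
  have e : q ^ 2 / q = q := by field_simp
  rw [theta_eq_poch (by simp [hq0]) (norm_pow_lt_one hq (by norm_num)) hq0, e, ← poch_odd_mul hq]
  ring

theorem thetaJ_three_twelve_mul {q : ℂ} (hq0 : q ≠ 0) (hq : ‖q‖ < 1) :
    thetaJ 3 12 q * poch (q ^ 6) (q ^ 6) = poch (q ^ 3) (q ^ 3) * poch (q ^ 12) (q ^ 12) := by
  have h1 := poch_odd_mul (norm_pow_lt_one hq (n := 3) (by norm_num))
  have h2 := poch_eq_prod 2 (q ^ 3) (norm_pow_lt_one hq (n := 6) (by norm_num))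
  have e : (q : ℂ) ^ 12 / q ^ 3 = q ^ 3 * q ^ 6 := by field_simp
  rw [thetaJ]
  norm_cast
  rw [theta_eq_poch (by simp [hq0]) (norm_pow_lt_one hq (by norm_num)) (by simp [hq0]), e, ← h1,
    ← pow_mul]
  simp only [Fin.prod_univ_two, ← pow_mul] at h2
  norm_num at h2 ⊢
  rw [h2]
  ring

theorem poch_neg_mul {q : ℂ} (hq : ‖q‖ < 1) :
    poch (-q) (q ^ 2) * (poch q q * poch (q ^ 4) (q ^ 4)) = poch (q ^ 2) (q ^ 2) ^ 2 := by
  have h2 := norm_pow_lt_one hq (n := 2) (by norm_num)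
  have h := poch_neg_mul_poch q h2
  have h3 := poch_odd_mul h2
  rw [← pow_mul] at h h3
  norm_num at h h3
  rw [← poch_odd_mul hq]
  linear_combination poch (q ^ 2) (q ^ 2) * (poch (q ^ 4) (q ^ 4) * h + h3)

/-- The theta contains the residue classes 1 and 5 of (-q;q²) modulo 6. The missing class 3 is
(-q³;q⁶), the same kind of product with q³ for q. -/
theorem theta_neg_pow_five_mul {q : ℂ} (hq0 : q ≠ 0) (hq : ‖q‖ < 1) :
    theta (-q ^ 5) (q ^ 6) * (poch q q * poch (q ^ 4) (q ^ 4) * poch (q ^ 6) (q ^ 6)) =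
      poch (q ^ 2) (q ^ 2) ^ 2 * poch (q ^ 3) (q ^ 3) * poch (q ^ 12) (q ^ 12) := by
  have h1 := poch_neg_mul hq
  have h2 := poch_neg_mul (norm_pow_lt_one hq (n := 3) (by norm_num))
  have h3 := poch_eq_prod 3 (-q) (norm_pow_lt_one hq (n := 2) (by norm_num))
  have e : q ^ 6 / -q ^ 5 = -q := by field_simp
  simp only [Fin.prod_univ_three, ← pow_mul] at h2 h3
  norm_num at h2 h3
  have e3 : q * q ^ 2 = q ^ 3 := by ring
  have e5 : q * q ^ 4 = q ^ 5 := by ring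
  rw [e3, e5] at h3
  rw [theta_eq_poch (by simp [hq0]) (norm_pow_lt_one hq (by norm_num)) (by simp [hq0]), e]
  rw [h3] at h1
  linear_combination poch (q ^ 3) (q ^ 3) * poch (q ^ 12) (q ^ 12) * h1 -
    poch (-q) (q ^ 6) * poch (-q ^ 5) (q ^ 6) * poch q q * poch (q ^ 4) (q ^ 4) * h2

/-! ### The Laurent coefficients of the reciprocal of a theta function -/

/-- The general term `(-1)^l q^{l(l+1)/2 + lk}`. -/
def recipTerm (q : ℂ) (k l : ℤ) : ℂ := (-1 : ℂ) ^ l * q ^ (l * (l - 1) / 2 + l * (k + 1))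

/-- The partial theta value `∑_{l ≥ 0} (-1)^l q^{l(l+1)/2 + lk}`. Up to the factor `J₁³`, it is
the coefficient of `x^k` in the expansion of `1 / j(x; q)` on the annulus `|q| < |x| < 1`. -/
def recipCoeff (q : ℂ) (k : ℤ) : ℂ := ∑' l : ℕ, recipTerm q k l

variable {q : ℂ}

theorem norm_zpow_le (hq0 : q ≠ 0) (hq : ‖q‖ < 1) {m n : ℤ} (h : m ≤ n) :
    ‖q ^ n‖ ≤ ‖q ^ m‖ := by
  rw [norm_zpow, norm_zpow]
  exact zpow_le_zpow_right_of_le_one₀ (norm_pos_iff.mpr hq0) hq.le h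

theorem summable_norm_recipTerm (hq0 : q ≠ 0) (hq : ‖q‖ < 1) (k : ℤ) :
    Summable fun l => ‖recipTerm q k l‖ :=
  (summable_norm_theta hq0 hq (zpow_ne_zero (k + 1) hq0)).congr fun l => by
    rw [recipTerm, zpow_add₀ hq0 (l * (l - 1) / 2), ← zpow_mul, mul_comm l (k + 1), mul_assoc]

theorem summable_norm_recipTerm_nat (hq0 : q ≠ 0) (hq : ‖q‖ < 1) (k : ℤ) :
    Summable fun l : ℕ => ‖recipTerm q k l‖ :=
  (summable_norm_recipTerm hq0 hq k).comp_injective Nat.cast_injective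

theorem summable_norm_recipTerm_neg (hq0 : q ≠ 0) (hq : ‖q‖ < 1) (k : ℤ) :
    Summable fun l : ℕ => ‖recipTerm q k (-((l : ℤ) + 1))‖ :=
  (summable_norm_recipTerm hq0 hq k).comp_injective fun a b h => by simpa using h

/-- The reflection l ↦ -1 - 2k - l preserves the exponent and flips the sign. -/
theorem tsum_recipTerm (q : ℂ) (k : ℤ) : ∑' l, recipTerm q k l = 0 := by
  have h : ∀ l, recipTerm q k (Equiv.subLeft (-1 - 2 * k) l) = -recipTerm q k l := by
    intro l
    rw [Equiv.subLeft_apply, recipTerm, recipTerm]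
    have e1 : (-1 - 2 * k - l) * (-1 - 2 * k - l - 1) / 2 + (-1 - 2 * k - l) * (k + 1) =
        l * (l - 1) / 2 + l * (k + 1) := by
      apply eq_of_two_mul
      have t1 := two_mul_tri (-1 - 2 * k - l)
      have t2 := two_mul_tri l
      linear_combination t1 - t2
    have e2 : (-1 : ℂ) ^ (-1 - 2 * k - l) = -(-1) ^ l := by
      have : -1 - 2 * k - l = -(l + 1 + 2 * k) := by ring
      rw [this, neg_one_zpow_neg, neg_one_zpow_add, neg_one_zpow_add,
        Even.neg_one_zpow (by simp : Even (2 * k))]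
      simp
    rw [e1, e2]
    ring
  have h2 := (Equiv.subLeft (-1 - 2 * k)).tsum_eq (recipTerm q k)
  rw [tsum_congr h, tsum_neg] at h2
  linear_combination (-1 / 2 : ℂ) * h2

theorem recipCoeff_eq_neg (hq0 : q ≠ 0) (hq : ‖q‖ < 1) (k : ℤ) :
    recipCoeff q k = -∑' l : ℕ, recipTerm q k (-((l : ℤ) + 1)) := by
  have h := tsum_of_nat_of_neg_add_one (summable_norm_recipTerm_nat hq0 hq k).of_norm
    (summable_norm_recipTerm_neg hq0 hq k).of_norm
  rw [tsum_recipTerm] at h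
  exact eq_neg_of_add_eq_zero_left h.symm

theorem recipCoeff_succ (hq0 : q ≠ 0) (hq : ‖q‖ < 1) (k : ℤ) :
    recipCoeff q k = 1 - q ^ (k + 1) * recipCoeff q (k + 1) := by
  rw [recipCoeff, (summable_norm_recipTerm_nat hq0 hq k).of_norm.tsum_eq_zero_add, recipCoeff,
    ← tsum_mul_left, sub_eq_add_neg, ← tsum_neg]
  congr 1
  · simp [recipTerm]
  · refine tsum_congr fun l => ?_
    rw [recipTerm, recipTerm]
    have e : ((l + 1 : ℕ) : ℤ) * (((l + 1 : ℕ) : ℤ) - 1) / 2 + ((l + 1 : ℕ) : ℤ) * (k + 1) =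
        (k + 1) + ((l : ℤ) * (l - 1) / 2 + l * (k + 1 + 1)) := by
      apply eq_of_two_mul
      have t1 := two_mul_tri ((l + 1 : ℕ) : ℤ)
      have t2 := two_mul_tri (l : ℤ)
      push_cast at t1 ⊢
      linear_combination t1 - t2
    rw [e, zpow_add₀ hq0 (k + 1), Nat.cast_succ, neg_one_zpow_add]
    simp
    ring

/-- For k ≥ 0 the defining series is used, for k < 0 the complementary one over negative l; in
either, the exponents are at least l(l-1)/2. -/
theorem exists_norm_recipCoeff_le (hq0 : q ≠ 0) (hq : ‖q‖ < 1) :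
    ∃ M : ℝ, ∀ k, ‖recipCoeff q k‖ ≤ M := by
  have hs : Summable fun l : ℕ => ‖q ^ ((l : ℤ) * (l - 1) / 2)‖ := by
    simpa using summable_norm_tri_nat hq0 hq one_ne_zero
  refine ⟨∑' l : ℕ, ‖q ^ ((l : ℤ) * (l - 1) / 2)‖, fun k => ?_⟩
  rcases le_or_gt 0 k with hk | hk
  · refine tsum_of_norm_bounded hs.hasSum fun l => ?_
    rw [recipTerm, norm_mul, norm_neg_one_zpow, one_mul]
    refine norm_zpow_le hq0 hq ?_
    have : 0 ≤ (l : ℤ) * (k + 1) := by positivity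
    omega
  · rw [recipCoeff_eq_neg hq0 hq, norm_neg]
    refine tsum_of_norm_bounded hs.hasSum fun l => ?_
    rw [recipTerm, norm_mul, norm_neg_one_zpow, one_mul]
    refine norm_zpow_le hq0 hq ?_
    have t1 := two_mul_tri (-((l : ℤ) + 1))
    have t2 := two_mul_tri (l : ℤ)
    have : 0 ≤ ((l : ℤ) + 1) * (-(k + 1)) := mul_nonneg (by positivity) (by omega)
    nlinarith

theorem summable_norm_theta_one (hq0 : q ≠ 0) (hq : ‖q‖ < 1) :
    Summable fun n : ℤ => ‖(-1 : ℂ) ^ n * q ^ (n * (n - 1) / 2)‖ := by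
  simpa using summable_norm_theta hq0 hq one_ne_zero

theorem tsum_theta_one (q : ℂ) : ∑' n : ℤ, (-1 : ℂ) ^ n * q ^ (n * (n - 1) / 2) = 0 := by
  have h := tsum_recipTerm q (-1)
  simpa [recipTerm] using h

/-- The coefficient of `x^N` in the product of `j(x; q)` with the series of `recipCoeff`. -/
def recipConv (q : ℂ) (N : ℤ) : ℂ :=
  ∑' n : ℤ, (-1 : ℂ) ^ n * q ^ (n * (n - 1) / 2) * recipCoeff q (N - n)

theorem summable_norm_mul_of_bounded {ι : Type*} {f c : ι → ℂ} (hf : Summable fun i => ‖f i‖)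
    {M : ℝ} (hc : ∀ i, ‖c i‖ ≤ M) : Summable fun i => ‖f i * c i‖ := by
  refine (hf.mul_right M).of_nonneg_of_le (fun i => norm_nonneg _) fun i => ?_
  rw [norm_mul]
  exact mul_le_mul_of_nonneg_left (hc i) (norm_nonneg _)

theorem summable_recipConv (hq0 : q ≠ 0) (hq : ‖q‖ < 1) (N : ℤ) :
    Summable fun n : ℤ => (-1 : ℂ) ^ n * q ^ (n * (n - 1) / 2) * recipCoeff q (N - n) := by
  obtain ⟨M, hM⟩ := exists_norm_recipCoeff_le hq0 hq
  exact (summable_norm_mul_of_bounded (summable_norm_theta_one hq0 hq) fun n => hM _).of_norm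

/-- Insert c(k) = 1 - q^{k+1} c(k+1): the constant 1 contributes j(1;q) = 0, and after the shift n ↦
n - 1 the rest is q^N times the original sum, while q^N ≠ 1. -/
theorem recipConv_eq_zero (hq0 : q ≠ 0) (hq : ‖q‖ < 1) {N : ℤ} (hN : N ≠ 0) :
    recipConv q N = 0 := by
  have hkey : recipConv q N = q ^ N * recipConv q N := by
    have h1 : ∀ n : ℤ, (-1 : ℂ) ^ n * q ^ (n * (n - 1) / 2) * recipCoeff q (N - n) =
        (-1 : ℂ) ^ n * q ^ (n * (n - 1) / 2) + q ^ N * ((-1 : ℂ) ^ (n - 1) *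
          q ^ ((n - 1) * (n - 1 - 1) / 2) * recipCoeff q (N - (n - 1))) := by
      intro n
      have e : q ^ (n * (n - 1) / 2) * q ^ (N - n + 1) =
          q ^ N * q ^ ((n - 1) * (n - 1 - 1) / 2) := by
        rw [← zpow_add₀ hq0, ← zpow_add₀ hq0]
        congr 1
        apply eq_of_two_mul
        have t1 := two_mul_tri n
        have t2 := two_mul_tri (n - 1)
        linear_combination t1 - t2
      have e2 : (-1 : ℂ) ^ n = -(-1) ^ (n - 1) := by
        have := neg_one_zpow_add (n - 1) 1
        simp only [sub_add_cancel] at this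
        rw [this]; simp
      have e3 : N - (n - 1) = N - n + 1 := by ring
      rw [recipCoeff_succ hq0 hq (N - n), e3, e2]
      linear_combination (-1) ^ (n - 1) * recipCoeff q (N - n + 1) * e
    have hs : Summable fun n : ℤ => (-1 : ℂ) ^ (n - 1) * q ^ ((n - 1) * (n - 1 - 1) / 2) *
        recipCoeff q (N - (n - 1)) :=
      (Equiv.subRight (1 : ℤ)).summable_iff.mpr (summable_recipConv hq0 hq N)
    have ht := (Equiv.subRight (1 : ℤ)).tsum_eq fun n : ℤ =>
      (-1 : ℂ) ^ n * q ^ (n * (n - 1) / 2) * recipCoeff q (N - n)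
    nth_rewrite 1 [recipConv]
    rw [tsum_congr h1, (summable_norm_theta_one hq0 hq).of_norm.tsum_add (hs.mul_left _),
      tsum_theta_one, zero_add, tsum_mul_left]
    exact congrArg _ ht
  have hne : (1 : ℂ) - q ^ N ≠ 0 := by
    intro h
    have h1 : ‖q ^ N‖ = 1 := by rw [← sub_eq_zero.mp h, norm_one]
    rw [norm_zpow, zpow_eq_one_iff_right₀ (norm_nonneg _) hq.ne] at h1
    exact hN h1
  have : (1 - q ^ N) * recipConv q N = 0 := by linear_combination hkey
  exact (mul_eq_zero.mp this).resolve_left hne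

/-! ### The constant `J₁³` -/

/-- The coefficients of `(1 - x)` times the series of `recipCoeff`. -/
def recipDiff (q : ℂ) (k : ℤ) : ℂ := recipCoeff q k - recipCoeff q (k - 1)

theorem norm_recipCoeff_sub_one_le (hq0 : q ≠ 0) (hq : ‖q‖ < 1) {M : ℝ}
    (hM : ∀ k, ‖recipCoeff q k‖ ≤ M) (k : ℤ) : ‖recipCoeff q k - 1‖ ≤ M * ‖q‖ ^ (k + 1) := by
  have h : recipCoeff q k - 1 = -(q ^ (k + 1) * recipCoeff q (k + 1)) := by
    rw [recipCoeff_succ hq0 hq k]; ring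
  rw [h, norm_neg, norm_mul, norm_zpow, mul_comm]
  exact mul_le_mul_of_nonneg_right (hM _) (by positivity)

theorem norm_recipCoeff_neg_le (hq0 : q ≠ 0) (hq : ‖q‖ < 1) {M : ℝ}
    (hM : ∀ k, ‖recipCoeff q k‖ ≤ M) (k : ℤ) : ‖recipCoeff q k‖ ≤ (1 + M) * ‖q‖ ^ (-k) := by
  have h1 := recipCoeff_succ hq0 hq (k - 1)
  rw [sub_add_cancel] at h1
  have h : recipCoeff q k = (1 - recipCoeff q (k - 1)) * q ^ (-k) := by
    rw [h1, zpow_neg]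
    field_simp [zpow_ne_zero k hq0]
    ring
  rw [h, norm_mul, norm_zpow]
  refine mul_le_mul_of_nonneg_right ((norm_sub_le _ _).trans ?_) (by positivity)
  rw [norm_one]
  linarith [hM (k - 1)]

theorem hasSum_of_telescope {f : ℕ → ℂ} {l : ℂ} (hf : Tendsto f atTop (𝓝 l))
    (hs : Summable fun n => f (n + 1) - f n) : HasSum (fun n => f (n + 1) - f n) (l - f 0) := by
  rw [hs.hasSum_iff_tendsto_nat]
  simp only [sum_range_sub]
  exact hf.sub_const _

theorem summable_recipDiff_and_tsum (hq0 : q ≠ 0) (hq : ‖q‖ < 1) :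
    (Summable fun k => ‖recipDiff q k‖) ∧ ∑' k, recipDiff q k = 1 := by
  obtain ⟨M, hM⟩ := exists_norm_recipCoeff_le hq0 hq
  have hM0 : 0 ≤ M := (norm_nonneg _).trans (hM 0)
  have hg := summable_geometric_of_lt_one (norm_nonneg q) hq
  have hg0 := tendsto_pow_atTop_nhds_zero_of_lt_one (norm_nonneg q) hq
  -- The differences telescope from c(-∞) = 0 to c(+∞) = 1. Both halves start at c(-1), with
  -- opposite signs, so it cancels.
  let f₁ : ℕ → ℂ := fun n => recipCoeff q ((n : ℤ) - 1)
  let f₂ : ℕ → ℂ := fun n => -recipCoeff q (-((n : ℤ) + 1))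
  have b₁ : ∀ n, ‖f₁ n - 1‖ ≤ M * ‖q‖ ^ n := fun n => by
    have := norm_recipCoeff_sub_one_le hq0 hq hM ((n : ℤ) - 1)
    simpa using this
  have b₂ : ∀ n, ‖f₂ n‖ ≤ (1 + M) * ‖q‖ ^ (n + 1) := fun n => by
    have := norm_recipCoeff_neg_le hq0 hq hM (-((n : ℤ) + 1))
    rw [neg_neg] at this
    rw [norm_neg]
    exact_mod_cast this
  have t₁ : Tendsto f₁ atTop (𝓝 1) := by
    rw [tendsto_iff_norm_sub_tendsto_zero]
    exact squeeze_zero (fun _ => norm_nonneg _) b₁ (by simpa using hg0.const_mul M)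
  have t₂ : Tendsto f₂ atTop (𝓝 0) := by
    refine squeeze_zero_norm b₂ ?_
    simpa using (hg0.comp (tendsto_add_atTop_nat 1)).const_mul (1 + M)
  have s₁ : Summable fun n => ‖f₁ (n + 1) - f₁ n‖ := by
    refine ((hg.mul_left (2 * M))).of_nonneg_of_le (fun _ => norm_nonneg _) fun n => ?_
    have : f₁ (n + 1) - f₁ n = (f₁ (n + 1) - 1) - (f₁ n - 1) := by ring
    rw [this]
    refine (norm_sub_le _ _).trans ?_
    have h1 := b₁ (n + 1)
    have h2 := b₁ n
    have h3 : ‖q‖ ^ (n + 1) ≤ ‖q‖ ^ n := pow_le_pow_of_le_one (norm_nonneg _) hq.le (by omega)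
    nlinarith
  have s₂ : Summable fun n => ‖f₂ (n + 1) - f₂ n‖ := by
    refine ((hg.mul_left (2 * (1 + M)))).of_nonneg_of_le (fun _ => norm_nonneg _) fun n => ?_
    refine (norm_sub_le _ _).trans ?_
    have h1 := b₂ (n + 1)
    have h2 := b₂ n
    have h3 : ‖q‖ ^ (n + 1) ≤ ‖q‖ ^ n := pow_le_pow_of_le_one (norm_nonneg _) hq.le (by omega)
    have h4 : ‖q‖ ^ (n + 1 + 1) ≤ ‖q‖ ^ n :=
      pow_le_pow_of_le_one (norm_nonneg _) hq.le (by omega)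
    nlinarith
  have c₁ : ∀ n : ℕ, f₁ (n + 1) - f₁ n = recipDiff q n := fun n => by
    simp [f₁, recipDiff]
  have c₂ : ∀ n : ℕ, f₂ (n + 1) - f₂ n = recipDiff q (-((n : ℤ) + 1)) := fun n => by
    simp only [f₂, recipDiff]
    have : -((n : ℤ) + 1) - 1 = -(((n + 1 : ℕ) : ℤ) + 1) := by push_cast; ring
    rw [this]
    ring
  have h₁ := hasSum_of_telescope t₁ s₁.of_norm
  have h₂ := hasSum_of_telescope t₂ s₂.of_norm
  simp only [c₁] at h₁ s₁
  simp only [c₂] at h₂ s₂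
  refine ⟨Summable.of_nat_of_neg_add_one s₁ s₂, ?_⟩
  rw [(h₁.of_nat_of_neg_add_one h₂).tsum_eq]
  simp [f₁, f₂]

/-- As c(k) → 1, the series of c(k) x^k diverges on the unit circle; the factor 1 - x makes it
absolutely convergent there. In the Cauchy product only the powers x⁰ and x¹ survive. -/
theorem tsum_recipDiff_mul_theta (hq0 : q ≠ 0) (hq : ‖q‖ < 1) {x : ℂ} (hx : ‖x‖ = 1) :
    (∑' k, recipDiff q k * x ^ k) * theta x q = (1 - x) * recipConv q 0 := by
  have hx0 : x ≠ 0 := by rintro rfl; simp at hx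
  have hsD : Summable fun k => ‖recipDiff q k * x ^ k‖ :=
    summable_norm_mul_of_bounded (summable_recipDiff_and_tsum hq0 hq).1 (M := 1)
      fun k => by simp [norm_zpow, hx]
  have hsT := summable_norm_theta hq0 hq hx0
  have hsP := summable_mul_of_summable_norm hsD hsT
  let e : ℤ × ℤ ≃ ℤ × ℤ :=
    { toFun := fun p => (p.1 - p.2, p.2)
      invFun := fun p => (p.1 + p.2, p.2)
      left_inv := fun p => by simp
      right_inv := fun p => by simp }
  have hsE := e.summable_iff.mpr hsP
  rw [theta, tsum_mul_tsum_of_summable_norm hsD hsT, ← e.tsum_eq]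
  refine hsE.tsum_prod.trans ?_
  have hin : ∀ N : ℤ, (∑' n : ℤ, recipDiff q (N - n) * x ^ (N - n) *
      ((-1 : ℂ) ^ n * q ^ (n * (n - 1) / 2) * x ^ n)) =
      x ^ N * (recipConv q N - recipConv q (N - 1)) := by
    intro N
    rw [recipConv, recipConv, ← (summable_recipConv hq0 hq N).tsum_sub
      (summable_recipConv hq0 hq (N - 1)), ← tsum_mul_left]
    refine tsum_congr fun n => ?_
    have e1 : x ^ N = x ^ (N - n) * x ^ n := by rw [← zpow_add₀ hx0]; congr 1; ring
    have e2 : N - 1 - n = N - n - 1 := by ring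
    rw [e1, recipDiff, e2]
    ring
  refine (tsum_congr hin).trans ?_
  rw [tsum_eq_sum (s := {0, 1})]
  · rw [sum_pair (by norm_num), recipConv_eq_zero hq0 hq (by norm_num : (1 : ℤ) ≠ 0),
      recipConv_eq_zero hq0 hq (by norm_num : (0 : ℤ) - 1 ≠ 0)]
    simp
    ring
  · intro N hN
    simp only [mem_insert, mem_singleton, not_or] at hN
    rw [recipConv_eq_zero hq0 hq hN.1, recipConv_eq_zero hq0 hq (by omega)]
    simp

theorem tendsto_poch (hq : ‖q‖ < 1) {x : ℕ → ℂ} {y : ℂ} (hx : Tendsto x atTop (𝓝 y)) {C : ℝ}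
    (hC : ∀ n, ‖x n‖ ≤ C) : Tendsto (fun n => poch (x n) q) atTop (𝓝 (poch y q)) := by
  have h := tendsto_tprod_one_add_of_dominated_convergence (𝓕 := atTop)
    (f := fun (n : ℕ) (k : ℕ) => -(x n * q ^ k)) (g := fun k => -(y * q ^ k))
    (bound := fun k => C * ‖q‖ ^ k)
    ((summable_geometric_of_lt_one (norm_nonneg _) hq).mul_left C)
    (fun k => (hx.mul_const _).neg)
    (Eventually.of_forall fun n k => by
      rw [norm_neg, norm_mul, norm_pow]
      exact mul_le_mul_of_nonneg_right (hC n) (by positivity))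
  simpa [poch, sub_eq_add_neg] using h

/-- Cancel 1 - x against the factor of the triple product that vanishes at x = 1, then let x → 1
along the unit circle. -/
theorem recipConv_zero (hq0 : q ≠ 0) (hq : ‖q‖ < 1) : recipConv q 0 = poch q q ^ 3 := by
  let x : ℕ → ℂ := fun n => Complex.exp (((1 / ((n : ℝ) + 1) : ℝ) : ℂ) * Complex.I)
  have hx1 : ∀ n, ‖x n‖ = 1 := fun n => Complex.norm_exp_ofReal_mul_I _
  have hxne : ∀ n, x n ≠ 1 := by
    intro n h
    have h2 := congrArg Complex.im h
    rw [Complex.exp_ofReal_mul_I_im, Complex.one_im] at h2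
    have h3 : 0 < (1 / ((n : ℝ) + 1) : ℝ) := by positivity
    have h4 : (1 / ((n : ℝ) + 1) : ℝ) ≤ 1 := by
      rw [div_le_one (by positivity)]; linarith [(Nat.cast_nonneg n : (0 : ℝ) ≤ n)]
    exact (Real.sin_pos_of_pos_of_lt_pi h3 (by linarith [Real.pi_gt_three])).ne' h2
  have hx : Tendsto x atTop (𝓝 1) := by
    have h1 : Tendsto (fun n : ℕ => ((1 / ((n : ℝ) + 1) : ℝ) : ℂ)) atTop (𝓝 ((0 : ℝ) : ℂ)) :=
      (Complex.continuous_ofReal.tendsto _).comp tendsto_one_div_add_atTop_nhds_zero_nat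
    have h2 := (h1.mul_const Complex.I).cexp
    rw [Complex.ofReal_zero, zero_mul, Complex.exp_zero] at h2
    exact h2
  obtain ⟨hs, hsum⟩ := summable_recipDiff_and_tsum hq0 hq
  have hB : Tendsto (fun n => ∑' k, recipDiff q k * x n ^ k) atTop
      (𝓝 (∑' k, recipDiff q k * 1 ^ k)) := by
    refine tendsto_tsum_of_dominated_convergence hs (fun k => ?_)
      (Eventually.of_forall fun n k => by simp [norm_zpow, hx1])
    exact (hx.zpow₀ k (Or.inl one_ne_zero)).const_mul _
  simp only [one_zpow, mul_one, hsum] at hB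
  have hP : Tendsto (fun n => poch (x n * q) q) atTop (𝓝 (poch (1 * q) q)) :=
    tendsto_poch hq (hx.mul_const q) (C := ‖q‖) fun n => by simp [hx1]
  have hR : Tendsto (fun n => poch (q / x n) q) atTop (𝓝 (poch (q / 1) q)) :=
    tendsto_poch hq (tendsto_const_nhds.div hx one_ne_zero) (C := ‖q‖) fun n => by simp [hx1]
  have hlim := hB.mul ((hP.const_mul (poch q q)).mul hR)
  have hconst : ∀ n, (∑' k, recipDiff q k * x n ^ k) *
      (poch q q * poch (x n * q) q * poch (q / x n) q) = recipConv q 0 := by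
    intro n
    have h := tsum_recipDiff_mul_theta hq0 hq (hx1 n)
    have hx0 : x n ≠ 0 := Complex.exp_ne_zero _
    rw [theta_eq_poch hq0 hq hx0, poch_eq_mul (x n) hq] at h
    have hne : 1 - x n ≠ 0 := sub_ne_zero.mpr (hxne n).symm
    apply mul_left_cancel₀ hne
    rw [← h]
    ring
  simp only [hconst] at hlim
  have := tendsto_nhds_unique tendsto_const_nhds hlim
  rw [this]
  simp
  ring

/-! ### The product `j(x; q) j(-x; q)` at the level of coefficients -/

theorem summable_theta_conv (hq0 : q ≠ 0) (hq : ‖q‖ < 1) {c : ℤ → ℂ} {M : ℝ}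
    (hc : ∀ k, ‖c k‖ ≤ M) :
    Summable fun p : ℤ × ℤ => q ^ (p.1 * (p.1 - 1) / 2) *
      ((-1 : ℂ) ^ p.2 * q ^ (p.2 * (p.2 - 1) / 2)) * c (p.2 + p.1) := by
  have h1 : Summable fun n : ℤ => ‖q ^ (n * (n - 1) / 2)‖ := by
    simpa using summable_norm_tri hq0 hq one_ne_zero
  exact (summable_norm_mul_of_bounded (h1.mul_norm (summable_norm_theta_one hq0 hq))
    fun p => hc _).of_norm

theorem tri_add_tri (l t : ℤ) :
    (l + t) * (l + t - 1) / 2 + (l - t) * (l - t - 1) / 2 =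
      2 * (l * (l - 1) / 2) + (2 * (t * (t - 1) / 2) + t) := by
  apply eq_of_two_mul
  have t1 := two_mul_tri (l + t)
  have t2 := two_mul_tri (l - t)
  have t3 := two_mul_tri l
  have t4 := two_mul_tri t
  linear_combination t1 + t2 - 2 * t3 - 2 * t4

/-- This is j(-x;q) j(x;q) = j(q;q²) j(x²;q²) with x^k replaced by c(k), so no convergence in x is
required. -/
theorem tsum_theta_conv (hq0 : q ≠ 0) (hq : ‖q‖ < 1) {c : ℤ → ℂ} {M : ℝ}
    (hc : ∀ k, ‖c k‖ ≤ M) :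
    ∑' m : ℤ, q ^ (m * (m - 1) / 2) *
        ∑' n : ℤ, (-1 : ℂ) ^ n * q ^ (n * (n - 1) / 2) * c (n + m) =
      theta q (q ^ 2) * ∑' l : ℤ, (-1 : ℂ) ^ l * (q ^ 2) ^ (l * (l - 1) / 2) * c (2 * l) := by
  have hsF := summable_theta_conv hq0 hq hc
  set F : ℤ × ℤ → ℂ := fun p => q ^ (p.1 * (p.1 - 1) / 2) *
      ((-1 : ℂ) ^ p.2 * q ^ (p.2 * (p.2 - 1) / 2)) * c (p.2 + p.1) with hF
  have hL : ∑' m : ℤ, q ^ (m * (m - 1) / 2) *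
      ∑' n : ℤ, (-1 : ℂ) ^ n * q ^ (n * (n - 1) / 2) * c (n + m) = ∑' p, F p := by
    rw [hsF.tsum_prod]
    refine tsum_congr fun m => ?_
    rw [← tsum_mul_left]
    exact tsum_congr fun n => by simp only [hF]; ring
  have hsS : Summable fun p : ℤ × ℤ => F p.swap := (Equiv.prodComm ℤ ℤ).summable_iff.mpr hsF
  have hS : ∑' p : ℤ × ℤ, F p.swap = ∑' p, F p := (Equiv.prodComm ℤ ℤ).tsum_eq F
  -- Symmetrising in the two indices cancels the terms with odd index sum; the others are
  -- parametrised by (l + t, l - t), where the exponent separates.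
  have h2 : 2 * ∑' p, F p = ∑' p, (F p + F p.swap) := by
    rw [hsF.tsum_add hsS, hS]; ring
  let ψ : ℤ × ℤ → ℤ × ℤ := fun p => (p.1 + p.2, p.1 - p.2)
  have hψ : Function.Injective ψ := by
    rintro ⟨a, b⟩ ⟨c, d⟩ h
    simp only [ψ, Prod.mk.injEq] at h
    ext <;> simp only <;> omega
  have hsupp : Function.support (fun p => F p + F p.swap) ⊆ Set.range ψ := by
    rintro ⟨n, m⟩ hp
    rcases Int.even_or_odd (n + m) with he | ho
    · obtain ⟨k, hk⟩ := he
      exact ⟨(k, n - k), by simp only [ψ, Prod.mk.injEq]; omega⟩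
    · exfalso
      apply hp
      simp only [hF, Prod.swap]
      have e : (-1 : ℂ) ^ n = -(-1) ^ m := by
        have h1 := ho.neg_one_zpow (α := ℂ)
        rw [neg_one_zpow_add] at h1
        linear_combination (-1) ^ m * h1 - (-1) ^ n * neg_one_zpow_mul_self m
      rw [e, add_comm m n]
      ring
  have hG : ∀ p : ℤ × ℤ, F (ψ p) + F (ψ p).swap =
      2 * (((-1 : ℂ) ^ p.2 * (q ^ 2) ^ (p.2 * (p.2 - 1) / 2) * q ^ p.2) *
        ((-1 : ℂ) ^ p.1 * (q ^ 2) ^ (p.1 * (p.1 - 1) / 2) * c (2 * p.1))) := by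
    rintro ⟨l, t⟩
    have e1 : (-1 : ℂ) ^ (l - t) = (-1) ^ l * (-1) ^ t := by
      rw [sub_eq_add_neg, neg_one_zpow_add, neg_one_zpow_neg]
    have e2 : q ^ ((l + t) * (l + t - 1) / 2) * q ^ ((l - t) * (l - t - 1) / 2) =
        (q ^ 2) ^ (l * (l - 1) / 2) * ((q ^ 2) ^ (t * (t - 1) / 2) * q ^ t) := by
      rw [← zpow_add₀ hq0, tri_add_tri, zpow_add₀ hq0, zpow_add₀ hq0, zpow_mul, zpow_mul]
      norm_cast
    have e3 : l - t + (l + t) = 2 * l := by ring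
    have e4 : l + t + (l - t) = 2 * l := by ring
    simp only [hF, ψ, Prod.swap, e1, e3, e4, neg_one_zpow_add l t]
    linear_combination 2 * (-1) ^ l * (-1) ^ t * c (2 * l) * e2
  have hn2 : ‖q ^ 2‖ < 1 := norm_pow_lt_one hq (by norm_num)
  have hs1 := summable_norm_theta (pow_ne_zero 2 hq0) hn2 hq0
  have hs2 : Summable fun l : ℤ =>
      ‖(-1 : ℂ) ^ l * (q ^ 2) ^ (l * (l - 1) / 2) * c (2 * l)‖ :=
    summable_norm_mul_of_bounded (summable_norm_theta_one (pow_ne_zero 2 hq0) hn2) fun l => hc _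
  rw [hL, theta, tsum_mul_tsum_of_summable_norm hs1 hs2]
  apply mul_left_cancel₀ (two_ne_zero (α := ℂ))
  rw [h2, ← hψ.tsum_eq hsupp, tsum_congr hG, tsum_mul_left]
  congr 1
  exact (Equiv.prodComm ℤ ℤ).tsum_eq fun p : ℤ × ℤ =>
    ((-1 : ℂ) ^ p.1 * (q ^ 2) ^ (p.1 * (p.1 - 1) / 2) * q ^ p.1) *
        ((-1 : ℂ) ^ p.2 * (q ^ 2) ^ (p.2 * (p.2 - 1) / 2) * c (2 * p.2))

/-! ### The Hecke-type double sum -/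

theorem heckeTerm_eq (hq0 : q ≠ 0) (r s : ℤ) :
    heckeTerm 4 4 1 (q ^ 4) (q ^ 3) q (r, s) =
      (if 0 ≤ r ∧ 0 ≤ s then 1 else if r < 0 ∧ s < 0 then -1 else 0) *
        ((-1 : ℂ) ^ r * ((q ^ 2) ^ 2) ^ ((-r) * (-r - 1) / 2) * recipTerm q (2 + 4 * r) s) := by
  rw [heckeTerm]
  simp only
  congr 1
  rw [neg_one_zpow_add, recipTerm, ← pow_mul]
  have e : (q ^ 4) ^ r * (q ^ 3) ^ s *
      q ^ (4 * (r * (r - 1) / 2) + 4 * r * s + 1 * (s * (s - 1) / 2)) =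
      (q ^ (2 * 2)) ^ ((-r) * (-r - 1) / 2) * q ^ (s * (s - 1) / 2 + s * (2 + 4 * r + 1)) := by
    simp only [← zpow_natCast q, ← zpow_mul, ← zpow_add₀ hq0]
    congr 1
    apply eq_of_two_mul
    have t1 := two_mul_tri r
    have t2 := two_mul_tri (-r)
    push_cast
    linear_combination 4 * t1 - 4 * t2
  linear_combination (-1) ^ r * (-1) ^ s * e

theorem summable_heckeTerm (hq0 : q ≠ 0) (hq : ‖q‖ < 1) :
    Summable (heckeTerm 4 4 1 (q ^ 4) (q ^ 3) q) := by
  have hQ : ((q ^ 2) ^ 2 : ℂ) ≠ 0 := by simp [hq0]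
  have hQ1 : ‖(q ^ 2) ^ 2‖ < 1 :=
    norm_pow_lt_one (norm_pow_lt_one hq (by norm_num)) (by norm_num)
  have h1 : Summable fun r : ℤ => ‖((q ^ 2) ^ 2) ^ ((-r) * (-r - 1) / 2)‖ := by
    have := (Equiv.neg ℤ).summable_iff.mpr (summable_norm_tri hQ hQ1 one_ne_zero)
    simpa [Function.comp_def] using this
  -- The cross exponent s(4r + 3) is smallest at r = 0 in the positive quadrant and at r = -1 in the
  -- negative one, which gives the ratios q³ and q⁻¹.
  have h2 : Summable fun s : ℤ => ‖q ^ (s * (s - 1) / 2) * (q ^ (3 : ℤ)) ^ s‖ +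
      ‖q ^ (s * (s - 1) / 2) * (q ^ (-1 : ℤ)) ^ s‖ :=
    (summable_norm_tri hq0 hq (zpow_ne_zero _ hq0)).add
      (summable_norm_tri hq0 hq (zpow_ne_zero _ hq0))
  have h := h1.mul_of_nonneg h2 (fun _ => norm_nonneg _) fun _ => by positivity
  refine Summable.of_norm_bounded h ?_
  rintro ⟨r, s⟩
  rw [heckeTerm_eq hq0, recipTerm]
  simp only
  rw [← zpow_mul, ← zpow_mul, ← zpow_add₀ hq0, ← zpow_add₀ hq0]
  split_ifs with hp hn
  · rw [one_mul, norm_mul, norm_mul, norm_neg_one_zpow, one_mul, norm_mul, norm_neg_one_zpow,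
      one_mul]
    gcongr
    refine (norm_zpow_le hq0 hq ?_).trans (le_add_of_nonneg_right (norm_nonneg _))
    nlinarith [mul_nonneg hp.1 hp.2]
  · rw [norm_mul, norm_neg, norm_one, one_mul, norm_mul, norm_mul, norm_neg_one_zpow, one_mul,
      norm_mul, norm_neg_one_zpow, one_mul]
    gcongr
    refine (norm_zpow_le hq0 hq ?_).trans (le_add_of_nonneg_left (norm_nonneg _))
    nlinarith [mul_nonneg (by omega : 0 ≤ -1 - r) (by omega : 0 ≤ -s)]
  · rw [zero_mul, norm_zero]
    positivity

theorem tsum_eq_tsum_nat_add_tsum_neg {f : ℤ → ℂ} (hf : Summable f) :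
    ∑' n, f n = ∑' n : ℕ, f n + ∑' n : ℕ, f (-((n : ℤ) + 1)) :=
  tsum_of_nat_of_neg_add_one (hf.comp_injective Nat.cast_injective)
    (hf.comp_injective (i := fun n : ℕ => -((n : ℤ) + 1)) fun a b h => by simpa using h)

/-- For r < 0 the inner sum runs over s < 0 with a minus sign, which is the same coefficient by
`recipCoeff_eq_neg`; the two quadrants thus merge into one sum over r. -/
theorem tsum_heckeTerm_right (hq0 : q ≠ 0) (hq : ‖q‖ < 1) (r : ℤ) :
    ∑' s : ℤ, heckeTerm 4 4 1 (q ^ 4) (q ^ 3) q (r, s) =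
      (-1 : ℂ) ^ r * ((q ^ 2) ^ 2) ^ ((-r) * (-r - 1) / 2) * recipCoeff q (2 + 4 * r) := by
  have hs : Summable fun s : ℤ => heckeTerm 4 4 1 (q ^ 4) (q ^ 3) q (r, s) :=
    (summable_heckeTerm hq0 hq).prod_factor r
  have hT := heckeTerm_eq hq0 r
  rw [tsum_eq_tsum_nat_add_tsum_neg hs]
  rcases le_or_gt 0 r with hr | hr
  · have h1 : ∀ l : ℕ, heckeTerm 4 4 1 (q ^ 4) (q ^ 3) q (r, (l : ℤ)) =
        (-1 : ℂ) ^ r * ((q ^ 2) ^ 2) ^ ((-r) * (-r - 1) / 2) * recipTerm q (2 + 4 * r) l :=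
      fun l => by rw [hT, if_pos ⟨hr, Nat.cast_nonneg l⟩, one_mul]
    have h2 : ∀ l : ℕ, heckeTerm 4 4 1 (q ^ 4) (q ^ 3) q (r, -((l : ℤ) + 1)) = 0 :=
      fun l => by rw [hT, if_neg (by omega), if_neg (by omega), zero_mul]
    rw [tsum_congr h1, tsum_congr h2, tsum_zero, add_zero, tsum_mul_left, recipCoeff]
  · have h1 : ∀ l : ℕ, heckeTerm 4 4 1 (q ^ 4) (q ^ 3) q (r, (l : ℤ)) = 0 :=
      fun l => by rw [hT, if_neg (by omega), if_neg (by omega), zero_mul]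
    have h2 : ∀ l : ℕ, heckeTerm 4 4 1 (q ^ 4) (q ^ 3) q (r, -((l : ℤ) + 1)) =
        (-1 : ℂ) ^ r * ((q ^ 2) ^ 2) ^ ((-r) * (-r - 1) / 2) *
          -recipTerm q (2 + 4 * r) (-((l : ℤ) + 1)) :=
      fun l => by rw [hT, if_neg (by omega), if_pos (by omega)]; ring
    rw [tsum_congr h1, tsum_congr h2, tsum_zero, zero_add, tsum_mul_left, tsum_neg,
      recipCoeff_eq_neg hq0 hq]

theorem heckeF_eq_tsum (hq0 : q ≠ 0) (hq : ‖q‖ < 1) :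
    heckeF 4 4 1 (q ^ 4) (q ^ 3) q =
      ∑' r : ℤ, (-1 : ℂ) ^ r * ((q ^ 2) ^ 2) ^ (r * (r - 1) / 2) *
        recipCoeff q (2 - 2 * (2 * r)) := by
  rw [heckeF, (summable_heckeTerm hq0 hq).tsum_prod, ← (Equiv.neg ℤ).tsum_eq]
  refine tsum_congr fun r => ?_
  rw [Equiv.neg_apply, tsum_heckeTerm_right hq0 hq, neg_neg, neg_one_zpow_neg]
  congr 2
  ring

/-- The total exponent is 3p² - 4p + 1, which equals 6·n(n-1)/2 + 5n for n = p - 1. -/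
theorem tsum_theta_neg_pow_five (hq0 : q ≠ 0) :
    ∑' p : ℤ, (q ^ 2) ^ (p * (p - 1) / 2) * q ^ ((2 - 2 * p) * (2 - 2 * p - 1) / 2) =
      theta (-q ^ 5) (q ^ 6) := by
  rw [theta, ← (Equiv.subRight (1 : ℤ)).tsum_eq
    fun n : ℤ => (-1 : ℂ) ^ n * (q ^ 6) ^ (n * (n - 1) / 2) * (-q ^ 5) ^ n]
  refine tsum_congr fun p => ?_
  rw [Equiv.subRight_apply, neg_eq_neg_one_mul (q ^ 5), mul_zpow]
  have e : (q ^ 6) ^ ((p - 1) * (p - 1 - 1) / 2) * (q ^ 5) ^ (p - 1) =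
      (q ^ 2) ^ (p * (p - 1) / 2) * q ^ ((2 - 2 * p) * (2 - 2 * p - 1) / 2) := by
    simp only [← zpow_natCast q, ← zpow_mul, ← zpow_add₀ hq0]
    congr 1
    apply eq_of_two_mul
    have t1 := two_mul_tri p
    have t2 := two_mul_tri (p - 1)
    have t3 := two_mul_tri (2 - 2 * p)
    push_cast
    linear_combination 6 * t2 - 2 * t1 - t3
  linear_combination -e - (q ^ 6) ^ ((p - 1) * (p - 1 - 1) / 2) * (q ^ 5) ^ (p - 1) *
    neg_one_zpow_mul_self (p - 1)

theorem theta_mul_theta_mul_heckeF (hq0 : q ≠ 0) (hq : ‖q‖ < 1) :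
    theta q (q ^ 2) * theta (q ^ 2) ((q ^ 2) ^ 2) * heckeF 4 4 1 (q ^ 4) (q ^ 3) q =
      poch q q ^ 3 * theta (-q ^ 5) (q ^ 6) := by
  obtain ⟨M, hM⟩ := exists_norm_recipCoeff_le hq0 hq
  have hin : ∀ p : ℤ, poch q q ^ 3 * q ^ ((2 - 2 * p) * (2 - 2 * p - 1) / 2) =
      theta q (q ^ 2) * ∑' l : ℤ, (-1 : ℂ) ^ l * (q ^ 2) ^ (l * (l - 1) / 2) *
        recipCoeff q (2 - 2 * (l + p)) := by
    intro p
    -- The inner sums become `recipConv` at 2 - 2p - m, so only m = 2 - 2p contributes.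
    have h := tsum_theta_conv hq0 hq (c := fun k => recipCoeff q (2 - 2 * p - k)) fun k => hM _
    have h1 : ∀ m : ℤ, ∑' n : ℤ, (-1 : ℂ) ^ n * q ^ (n * (n - 1) / 2) *
        recipCoeff q (2 - 2 * p - (n + m)) = recipConv q (2 - 2 * p - m) := fun m => by
      rw [recipConv]
      exact tsum_congr fun n => by congr 2; ring
    simp only [h1] at h
    rw [tsum_eq_single (2 - 2 * p) fun m hm => by
      rw [recipConv_eq_zero hq0 hq (by omega), mul_zero], sub_self, recipConv_zero hq0 hq] at h
    rw [mul_comm, h]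
    congr 1
    exact tsum_congr fun n => by congr 2; ring
  -- The second use of the product formula, with q² for q, passes from j(x²;q²) to j(x⁴;q⁴).
  have h2 := tsum_theta_conv (pow_ne_zero 2 hq0) (norm_pow_lt_one hq (by norm_num : 2 ≠ 0))
    (c := fun k => recipCoeff q (2 - 2 * k)) fun k => hM _
  rw [heckeF_eq_tsum hq0 hq, mul_assoc, ← h2, ← tsum_mul_left, ← tsum_theta_neg_pow_five hq0,
    ← tsum_mul_left]
  refine tsum_congr fun p => ?_
  linear_combination -(q ^ 2) ^ (p * (p - 1) / 2) * hin p

theorem heckeF_eq (hq0 : q ≠ 0) (hq : ‖q‖ < 1) :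
    heckeF 4 4 1 (q ^ 4) (q ^ 3) q = eulerJ 2 q * thetaJ 3 12 q := by
  have hn : ∀ {k : ℕ}, k ≠ 0 → poch (q ^ k) (q ^ k) ≠ 0 := fun hk =>
    poch_self_ne_zero (norm_pow_lt_one hq hk)
  have h := theta_mul_theta_mul_heckeF hq0 hq
  have h1 := theta_sq_mul hq0 hq
  have h2 := theta_sq_mul (pow_ne_zero 2 hq0) (norm_pow_lt_one hq (by norm_num : 2 ≠ 0))
  have h3 := theta_neg_pow_five_mul hq0 hq
  have h4 := thetaJ_three_twelve_mul hq0 hq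
  have h5 := eulerJ_eq_poch hq0 hq (m := 2) (by norm_num)
  rw [show ((q ^ 2) ^ 2 : ℂ) = q ^ 4 by ring] at h h2
  norm_cast at h5
  have n1 := poch_self_ne_zero hq
  have n2 := hn (k := 2) (by norm_num)
  have n6 := hn (k := 6) (by norm_num)
  rw [h5]
  generalize heckeF 4 4 1 (q ^ 4) (q ^ 3) q = f at *
  generalize thetaJ 3 12 q = T at *
  generalize theta (-q ^ 5) (q ^ 6) = Θ at *
  generalize theta q (q ^ 2) = A at *
  generalize theta (q ^ 2) (q ^ 4) = B at *
  generalize poch q q = E₁ at *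
  generalize poch (q ^ 2) (q ^ 2) = E₂ at *
  generalize poch (q ^ 3) (q ^ 3) = E₃ at *
  generalize poch (q ^ 4) (q ^ 4) = E₄ at *
  generalize poch (q ^ 6) (q ^ 6) = E₆ at *
  generalize poch (q ^ 12) (q ^ 12) = E₁₂ at *
  have hc : E₁ ^ 3 * E₂ ^ 2 * E₆ ≠ 0 := by simp [n1, n2, n6]
  apply mul_left_cancel₀ hc
  linear_combination E₂ * E₄ * E₁ * E₆ * h - f * E₁ * E₆ * (B * E₄ * h1 + E₁ ^ 2 * h2) +
    E₁ ^ 3 * E₂ * h3 - E₁ ^ 3 * E₂ ^ 3 * h4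

/-! ### Powers of the nome and the eta function -/

theorem qPow_add (τ : UpperHalfPlane) (x y : ℝ) : qPow τ (x + y) = qPow τ x * qPow τ y := by
  rw [qPow, qPow, qPow, ← Complex.exp_add]
  congr 1
  push_cast
  ring

theorem qPow_ne_zero (τ : UpperHalfPlane) (x : ℝ) : qPow τ x ≠ 0 := Complex.exp_ne_zero _

theorem qPow_intCast (τ : UpperHalfPlane) (n : ℤ) : qPow τ n = qPow τ 1 ^ n := by
  rw [qPow, qPow, ← Complex.exp_int_mul]
  congr 1
  push_cast
  ring

theorem norm_qPow_one_lt (τ : UpperHalfPlane) : ‖qPow τ 1‖ < 1 := by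
  have h := UpperHalfPlane.norm_exp_two_pi_I_lt_one τ
  simpa [qPow] using h

theorem eta_natCast_mul (τ : UpperHalfPlane) (k : ℕ) :
    ModularForm.eta (k * (τ : ℂ)) = qPow τ (k / 24) * poch (qPow τ 1 ^ k) (qPow τ 1 ^ k) := by
  rw [ModularForm.eta, poch]
  congr 1
  · rw [Function.Periodic.qParam, qPow]
    congr 1
    push_cast
    ring
  · refine tprod_congr fun n => ?_
    rw [ModularForm.eta_q_eq_pow, ← pow_succ', qPow, ← Complex.exp_nat_mul _ k]
    congr 3
    push_cast
    ring

theorem eta_coe (τ : UpperHalfPlane) :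
    ModularForm.eta (τ : ℂ) = qPow τ (1 / 24) * poch (qPow τ 1) (qPow τ 1) := by
  simpa using eta_natCast_mul τ 1

/-! ### The index set of the string function -/

/-- In the coordinates X = 4x, Y = 12y the two cosets are Y ≡ 1 and Y ≡ 7 modulo 12, both with X ≡ 1
modulo 4. -/
theorem mem_stringIndex_iff (p : ℝ × ℝ) : p ∈ stringIndex 6 3 1 ↔
    ∃ X Y : ℤ, X % 4 = 1 ∧ Y % 6 = 1 ∧ -(3 * |X|) < Y ∧ Y ≤ 3 * |X| ∧
      p = ((X : ℝ) / 4, (Y : ℝ) / 12) := by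
  have hl : ∀ p : ℝ × ℝ, (p ∈ shiftedLattice 6 3 1 ∨
      (1 / 2 - p.1, 1 / 2 + p.2) ∈ shiftedLattice 6 3 1) ↔
      ∃ X Y : ℤ, X % 4 = 1 ∧ Y % 6 = 1 ∧ p = ((X : ℝ) / 4, (Y : ℝ) / 12) := by
    rintro ⟨x, y⟩
    simp only [shiftedLattice, Set.mem_ofPred_eq, Prod.mk.injEq]
    constructor
    · rintro (⟨i, k, hi, hk⟩ | ⟨i, k, hi, hk⟩)
      · refine ⟨4 * i + 1, 12 * k + 1, by omega, by omega, ?_, ?_⟩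
        · rw [hi]; push_cast; ring
        · rw [hk]; push_cast; ring
      · refine ⟨1 - 4 * i, 12 * k - 5, by omega, by omega, ?_, ?_⟩
        · push_cast at hi ⊢; linarith
        · push_cast at hk ⊢; linarith
    · rintro ⟨X, Y, hX, hY, rfl, rfl⟩
      obtain ⟨i, rfl⟩ : ∃ i, X = 4 * i + 1 := ⟨X / 4, by omega⟩
      rcases (by omega : Y % 12 = 1 ∨ Y % 12 = 7) with h | h
      · obtain ⟨k, rfl⟩ : ∃ k, Y = 12 * k + 1 := ⟨Y / 12, by omega⟩
        refine Or.inl ⟨i, k, ?_, ?_⟩ <;> push_cast <;> ring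
      · obtain ⟨k, rfl⟩ : ∃ k, Y = 12 * k + 7 := ⟨Y / 12, by omega⟩
        refine Or.inr ⟨-i, k + 1, ?_, ?_⟩ <;> push_cast <;> ring
  have hb : ∀ X Y : ℤ, (-|(X : ℝ) / 4| < (Y : ℝ) / 12 ∧ (Y : ℝ) / 12 ≤ |(X : ℝ) / 4|) ↔
      (-(3 * |X|) < Y ∧ Y ≤ 3 * |X|) := by
    intro X Y
    have e : |(X : ℝ) / 4| = ((|X| : ℤ) : ℝ) / 4 := by
      rw [abs_div, Int.cast_abs]; norm_num
    rw [e, ← Int.cast_lt (R := ℝ), ← Int.cast_le (R := ℝ)]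
    push_cast
    constructor <;> rintro ⟨h1, h2⟩ <;> constructor <;> linarith
  constructor
  · rintro ⟨h1, h2, h3⟩
    obtain ⟨X, Y, hX, hY, rfl⟩ := (hl p).mp h3
    obtain ⟨h4, h5⟩ := (hb X Y).mp ⟨h1, h2⟩
    exact ⟨X, Y, hX, hY, h4, h5, rfl⟩
  · rintro ⟨X, Y, hX, hY, h4, h5, rfl⟩
    obtain ⟨h1, h2⟩ := (hb X Y).mpr ⟨h4, h5⟩
    exact ⟨h1, h2, (hl _).mpr ⟨X, Y, hX, hY, rfl⟩⟩

/-- The integer `(-1)^u (2u+1)`. -/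
def altOdd (u : ℤ) : ℤ := if u % 2 = 0 then 2 * u + 1 else -(2 * u + 1)

theorem altOdd_sq (u : ℤ) : altOdd u ^ 2 = (2 * u + 1) ^ 2 := by
  rw [altOdd]; split_ifs <;> ring

/-- The pairs `(r, s)` that occur in a Hecke-type double sum. -/
def sameSign : Set (ℤ × ℤ) := {p | (0 ≤ p.1 ∧ 0 ≤ p.2) ∨ (p.1 < 0 ∧ p.2 < 0)}

/-- The point of the Kac–Peterson double sum that corresponds to `(r, s)`. -/
def toIndex (p : ℤ × ℤ) : ℝ × ℝ := ((altOdd (p.1 + p.2) : ℝ) / 4, ((1 - 6 * p.2 : ℤ) : ℝ) / 12)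

/-- Each X ≡ 1 modulo 4 equals `altOdd u` for exactly two u, exchanged by u ↦ -1 - u. The cone
condition leaves only the u = r + s for which r and s have the same sign. -/
theorem bijOn_toIndex : Set.BijOn toIndex sameSign (stringIndex 6 3 1) := by
  refine ⟨?_, ?_, ?_⟩
  · rintro ⟨r, s⟩ h
    rw [mem_stringIndex_iff]
    refine ⟨altOdd (r + s), 1 - 6 * s, ?_, by omega, ?_, ?_, rfl⟩
    · rw [altOdd]; split_ifs <;> omega
    all_goals
      simp only [sameSign, Set.mem_ofPred_eq] at h
      rcases abs_cases (altOdd (r + s)) with ⟨h1, h2⟩ | ⟨h1, h2⟩ <;> rw [h1] <;>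
        simp only [altOdd] at h2 ⊢ <;> split_ifs at h2 ⊢ <;> omega
  · rintro ⟨r, s⟩ h ⟨r', s'⟩ h' he
    simp only [toIndex, Prod.mk.injEq] at he
    obtain ⟨h1, h2⟩ := he
    have e1 : altOdd (r + s) = altOdd (r' + s') := by
      have : (altOdd (r + s) : ℝ) = altOdd (r' + s') := by linarith
      exact_mod_cast this
    have e2 : 1 - 6 * s = 1 - 6 * s' := by
      have : ((1 - 6 * s : ℤ) : ℝ) = ((1 - 6 * s' : ℤ) : ℝ) := by linarith
      exact_mod_cast this
    simp only [sameSign, Set.mem_ofPred_eq] at h h'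
    simp only [altOdd] at e1
    simp only [Prod.mk.injEq]
    split_ifs at e1 <;> omega
  · intro p hp
    obtain ⟨X, Y, hX, hY, h1, h2, rfl⟩ := (mem_stringIndex_iff p).mp hp
    obtain ⟨s, rfl⟩ : ∃ s, Y = 1 - 6 * s := ⟨(1 - Y) / 6, by omega⟩
    have key : ∃ u, altOdd u = X ∧ ((0 ≤ u - s ∧ 0 ≤ s) ∨ (u - s < 0 ∧ s < 0)) := by
      rcases abs_cases X with ⟨h3, h4⟩ | ⟨h3, h4⟩ <;> rw [h3] at h1 h2 <;>
        rcases le_or_gt 0 s with hs | hs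
      · exact ⟨(X - 1) / 2, by rw [altOdd]; split_ifs <;> omega, by omega⟩
      · exact ⟨-((X + 1) / 2), by rw [altOdd]; split_ifs <;> omega, by omega⟩
      · exact ⟨(-X - 1) / 2, by rw [altOdd]; split_ifs <;> omega, by omega⟩
      · exact ⟨-((-X + 1) / 2), by rw [altOdd]; split_ifs <;> omega, by omega⟩
    obtain ⟨u, hu, hv⟩ := key
    refine ⟨(u - s, s), hv, ?_⟩
    simp only [toIndex, sub_add_cancel, hu]

theorem stringTerm_toIndex (τ : UpperHalfPlane) {p : ℤ × ℤ} (hp : p ∈ sameSign) :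
    stringTerm 6 τ (toIndex p) = qPow τ (11 / 24) *
      heckeTerm 4 4 1 (qPow τ 1 ^ 4) (qPow τ 1 ^ 3) (qPow τ 1) p := by
  obtain ⟨r, s⟩ := p
  have hq0 := qPow_ne_zero τ 1
  -- On the two quadrants r + s has their common sign, so sg(x) is the Hecke sign times (-1)^{r+s}.
  have hsgn : (if 0 ≤ (altOdd (r + s) : ℝ) / 4 then (1 : ℂ) else -1) =
      (if 0 ≤ r ∧ 0 ≤ s then 1 else if r < 0 ∧ s < 0 then -1 else 0) * (-1) ^ (r + s) := by
    have h0 : 0 ≤ (altOdd (r + s) : ℝ) / 4 ↔ 0 ≤ altOdd (r + s) := by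
      rw [← Int.cast_nonneg_iff (R := ℝ)]
      constructor <;> intro h <;> linarith
    simp only [h0]
    simp only [sameSign, Set.mem_ofPred_eq] at hp
    rcases Int.even_or_odd (r + s) with he | ho
    · rw [he.neg_one_zpow]
      rw [Int.even_iff] at he
      simp only [altOdd, he, if_true]
      rcases hp with hp | hp
      · rw [if_pos (by omega), if_pos hp, mul_one]
      · rw [if_neg (by omega), if_neg (by omega), if_pos hp, mul_one]
    · rw [ho.neg_one_zpow]
      rw [Int.odd_iff] at ho
      simp only [altOdd, ho, one_ne_zero, if_false]
      rcases hp with hp | hp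
      · rw [if_neg (by omega), if_pos hp, one_mul]
      · rw [if_pos (by omega), if_neg (by omega), if_pos hp]; norm_num
  have hexp : ((6 : ℤ) + 2 : ℝ) * ((altOdd (r + s) : ℝ) / 4) ^ 2 -
      ((6 : ℤ) : ℝ) * (((1 - 6 * s : ℤ) : ℝ) / 12) ^ 2 = 11 / 24 +
      ((4 * r + 3 * s + (4 * (r * (r - 1) / 2) + 4 * r * s + 1 * (s * (s - 1) / 2)) : ℤ) : ℝ) := by
    have a1 : ((altOdd (r + s) : ℝ)) ^ 2 = (2 * (r + s) + 1) ^ 2 := by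
      exact_mod_cast altOdd_sq (r + s)
    have t1 : (2 : ℝ) * ((r * (r - 1) / 2 : ℤ) : ℝ) = r * (r - 1) := by
      exact_mod_cast two_mul_tri r
    have t2 : (2 : ℝ) * ((s * (s - 1) / 2 : ℤ) : ℝ) = s * (s - 1) := by
      exact_mod_cast two_mul_tri s
    rw [Int.cast_add, Int.cast_add, Int.cast_add, Int.cast_add, Int.cast_mul 4 (r * (r - 1) / 2),
      Int.cast_mul 1 (s * (s - 1) / 2)]
    generalize ((r * (r - 1) / 2 : ℤ) : ℝ) = T₁ at t1 ⊢
    generalize ((s * (s - 1) / 2 : ℤ) : ℝ) = T₂ at t2 ⊢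
    push_cast
    linear_combination a1 / 2 - 2 * t1 - t2 / 2
  have hpow : (qPow τ 1 ^ 4) ^ r * (qPow τ 1 ^ 3) ^ s *
      qPow τ 1 ^ (4 * (r * (r - 1) / 2) + 4 * r * s + 1 * (s * (s - 1) / 2)) =
      qPow τ 1 ^ (4 * r + 3 * s + (4 * (r * (r - 1) / 2) + 4 * r * s + 1 * (s * (s - 1) / 2))) := by
    rw [zpow_add₀ hq0 (4 * r + 3 * s), zpow_add₀ hq0 (4 * r), zpow_mul, zpow_mul]
    norm_cast
  rw [stringTerm, toIndex, heckeTerm]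
  simp only
  rw [hsgn, hexp, qPow_add, qPow_intCast, ← hpow]
  ring

theorem support_heckeTerm_subset (a b c : ℤ) (x y q : ℂ) :
    Function.support (heckeTerm a b c x y q) ⊆ sameSign := by
  intro p hp
  by_contra h
  apply hp
  simp only [sameSign, Set.mem_ofPred_eq, not_or] at h
  rw [heckeTerm, if_neg h.1, if_neg h.2, zero_mul]

theorem hasSum_stringTerm (τ : UpperHalfPlane) :
    HasSum (fun p : stringIndex 6 3 1 => stringTerm 6 τ p)
      (qPow τ (11 / 24) * heckeF 4 4 1 (qPow τ 1 ^ 4) (qPow τ 1 ^ 3) (qPow τ 1)) := by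
  have h := (summable_heckeTerm (qPow_ne_zero τ 1) (norm_qPow_one_lt τ)).hasSum
  rw [← hasSum_subtype_iff_of_support_subset (support_heckeTerm_subset _ _ _ _ _ _)] at h
  rw [← (Set.BijOn.equiv toIndex bijOn_toIndex).hasSum_iff]
  convert! h.mul_left (qPow τ (11 / 24)) using 1
  funext p
  exact stringTerm_toIndex τ p.2

theorem stringFunction_eq (τ : UpperHalfPlane) :
    stringFunction 6 3 1 τ = (ModularForm.eta (τ : ℂ) ^ 3)⁻¹ *
      (qPow τ (11 / 24) * heckeF 4 4 1 (qPow τ 1 ^ 4) (qPow τ 1 ^ 3) (qPow τ 1)) := by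
  rw [stringFunction, (hasSum_stringTerm τ).tsum_eq]

theorem stringFunction_eq_heckeF (τ : UpperHalfPlane) :
    stringFunction 6 3 1 τ = qPow τ (sExponent 1 3 6) / eulerJ 1 (qPow τ 1) ^ 3 *
      heckeF 4 4 1 (qPow τ 1 ^ 4) (qPow τ 1 ^ 3) (qPow τ 1) := by
  have hq0 := qPow_ne_zero τ 1
  have hq := norm_qPow_one_lt τ
  have hJ := eulerJ_eq_poch hq0 hq one_ne_zero
  rw [Nat.cast_one, pow_one] at hJ
  -- 11/24 = 1/3 + 3/24, the last part coming from η³.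
  have e : qPow τ (11 / 24) = qPow τ (sExponent 1 3 6) * qPow τ (1 / 24) ^ 3 := by
    rw [pow_succ, pow_two, ← qPow_add, ← qPow_add, ← qPow_add]
    congr 1
    norm_num [sExponent]
  rw [stringFunction_eq, eta_coe, hJ, e]
  have h1 := qPow_ne_zero τ (1 / 24)
  have h2 := poch_self_ne_zero hq
  field_simp

theorem stringFunction_eq_eta (τ : UpperHalfPlane) :
    stringFunction 6 3 1 τ =
      (ModularForm.eta (τ : ℂ) ^ 3)⁻¹ * ModularForm.eta (2 * (τ : ℂ)) *
        ModularForm.eta (3 * (τ : ℂ)) * (ModularForm.eta (6 * (τ : ℂ)))⁻¹ *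
        ModularForm.eta (12 * (τ : ℂ)) := by
  have hq0 := qPow_ne_zero τ 1
  have hq := norm_qPow_one_lt τ
  have hJ := eulerJ_eq_poch hq0 hq two_ne_zero
  have hT := thetaJ_three_twelve_mul hq0 hq
  have e2 := eta_natCast_mul τ 2
  have e3 := eta_natCast_mul τ 3
  have e6 := eta_natCast_mul τ 6
  have e12 := eta_natCast_mul τ 12
  push_cast at hJ e2 e3 e6 e12
  have e : qPow τ (11 / 24) * qPow τ (6 / 24) =
      qPow τ (2 / 24) * qPow τ (3 / 24) * qPow τ (12 / 24) := by
    rw [← qPow_add, ← qPow_add, ← qPow_add]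
    norm_num
  rw [stringFunction_eq, heckeF_eq hq0 hq, hJ, e2, e3, e6, e12]
  have h6 := poch_self_ne_zero (norm_pow_lt_one hq (by norm_num : 6 ≠ 0))
  have h7 := qPow_ne_zero τ (6 / 24)
  have key : qPow τ (11 / 24) * thetaJ 3 12 (qPow τ 1) =
      qPow τ (2 / 24) * qPow τ (3 / 24) * qPow τ (12 / 24) *
        (poch (qPow τ 1 ^ 3) (qPow τ 1 ^ 3) * poch (qPow τ 1 ^ 12) (qPow τ 1 ^ 12)) *
        (qPow τ (6 / 24) * poch (qPow τ 1 ^ 6) (qPow τ 1 ^ 6))⁻¹ := by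
    rw [eq_mul_inv_iff_mul_eq₀ (mul_ne_zero h7 h6), ← hT, ← e]
    ring
  linear_combination (ModularForm.eta (τ : ℂ) ^ 3)⁻¹ *
    poch (qPow τ 1 ^ 2) (qPow τ 1 ^ 2) * key

end StringFn

end

theorem mainTheorem8 :
    -- the double-sum evaluation `f_{4,4,1}(q⁴, q³, q) = J₂ J_{3,12}`
    (∀ q : ℂ, q ≠ 0 → ‖q‖ < 1 →
      Summable (StringFn.heckeTerm 4 4 1 (q ^ 4) (q ^ 3) q) ∧
      StringFn.heckeF 4 4 1 (q ^ 4) (q ^ 3) q =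
        StringFn.eulerJ 2 q * StringFn.thetaJ 3 12 q) ∧
    -- the string function `c^{33}_{51}`: its expression through that double sum,
    -- and its evaluation as an eta quotient
    (∀ τ : UpperHalfPlane,
      Summable (fun p : StringFn.stringIndex 6 3 1 => StringFn.stringTerm 6 τ p) ∧
      StringFn.stringFunction 6 3 1 τ =
        StringFn.qPow τ (StringFn.sExponent 1 3 6) /
            StringFn.eulerJ 1 (StringFn.qPow τ 1) ^ 3 *
          StringFn.heckeF 4 4 1 (StringFn.qPow τ 1 ^ 4) (StringFn.qPow τ 1 ^ 3)
            (StringFn.qPow τ 1) ∧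
      StringFn.stringFunction 6 3 1 τ =
        (ModularForm.eta (τ : ℂ) ^ 3)⁻¹ * ModularForm.eta (2 * (τ : ℂ)) *
          ModularForm.eta (3 * (τ : ℂ)) * (ModularForm.eta (6 * (τ : ℂ)))⁻¹ *
          ModularForm.eta (12 * (τ : ℂ))) :=
  ⟨fun _ hq0 hq => ⟨StringFn.summable_heckeTerm hq0 hq, StringFn.heckeF_eq hq0 hq⟩,
    fun τ => ⟨(StringFn.hasSum_stringTerm τ).summable, StringFn.stringFunction_eq_heckeF τ,
      StringFn.stringFunction_eq_eta τ⟩⟩
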